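/- For a C*-algebra $B$ let $\mathrm{Cu}(B)=(B\otimes\mathcal K)_+/\!\sim$ be its Cuntz semigroup, where $\mathcal K$ denotes the compact operators on $\ell^2(\mathbb N)$ with matrix units $e_{ij}$; here $a\precsim b$ means that $x_nbx_n^*\to a$ in norm for some sequence $(x_n)$ in $B\otimes\mathcal K$, and $a\sim b$ means $a\precsim b$ and $b\precsim a$. It is ordered by $[a]\le[b]$ if $a\precsim b$, with addition $[a]+[b]=[w_0aw_0^*+w_1bw_1^*]$, where $w_0,w_1$ are the isometries $w_re_n=e_{2n+r}$ in the multiplier algebra of $\mathcal K$. For $b\in B_+$ write $[b]=[b\otimes e_{00}]\in\mathrm{Cu}(B)$. In an ordered semigroup, $s\ll t$ means that whenever $t\le\sup_nz_n$ for an increasing sequence $(z_n)$ that has a supremum, then $s\le z_m$ for some $m$. A $\ll$-bimorphism is a map $\varphi\colon S\times T\to R$ such that all the maps $\varphi(s,\cdot)$ and $\varphi(\cdot,t)$ preserve order, addition and suprema of increasing sequences, and such that $\varphi(s',t')\ll\varphi(s,t)$ whenever $s'\ll s$ and $t'\ll t$. Let $X$ be a compact Hausdorff space and let $A$ be a stable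 $\mathrm C(X)$-algebra, that is, a C*-algebra with $A\cong A\otimes\mathcal K$, together with a unital $*$-homomorphism $\theta\colon\mathrm C(X)\to Z(\mathcal M(A))$ to the centre of its multiplier algebra. Then the map $\mathrm C(X)\times A\to A$, $(f,a)\mapsto\theta(f)a$, induces a $\ll$-bimorphism $$\gamma_A\colon\mathrm{Cu}(\mathrm C(X))\times\mathrm{Cu}(A)\to\mathrm{Cu}(A),\qquad \gamma_A([f],[a])=[\theta(f)a]\quad\text{for } f\in\mathrm C(X)_+,\ a\in A_+ .$$ That it is induced by this map means the following: for $F\in(\mathrm C(X)\otimes\mathcal K)_+$ with matrix entries $F_{ij}\in\mathrm C(X)$ and for $a\in A_+$, there is a positive element $F\cdot a$ of $A\otimes\mathcal K$ with matrix entries $\theta(F_{ij})a$, and $\gamma_A([F],[a])=[F\cdot a]$. There is exactly one $\ll$-bimorphism $\gamma_A$ with these properties. It is called the action of $\mathrm{Cu}(\mathrm C(X))$ on $\mathrm{Cu}(A)$. -/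

import Mathlib

open Filter Topology UniformSpace
open scoped MultiplierAlgebra

noncomputable section

namespace CuntzAction

/-! ## The stabilization `A ⊗ K` of a C*-algebra

`A ⊗ K` is built as the completion of the pre-C*-algebra of finitely supported `ℕ × ℕ` matrices
over `A`, the increasing union of the C*-algebras `M_N(A)`. -/

section FiniteMatrices

variable (A : Type*) [NonUnitalCStarAlgebra A]

/-- The matrices `ℕ × ℕ → A` which vanish outside some upper left corner `N × N`. -/
def finMatSubmodule : Submodule ℂ (ℕ → ℕ → A) where
  carrier := {x | ∃ N, ∀ i j, N ≤ i ∨ N ≤ j → x i j = 0}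
  zero_mem' := ⟨0, fun _ _ _ => rfl⟩
  add_mem' := by
    rintro x y ⟨N, hN⟩ ⟨M, hM⟩
    refine ⟨max N M, fun i j h => ?_⟩
    have h1 : N ≤ i ∨ N ≤ j := by omega
    have h2 : M ≤ i ∨ M ≤ j := by omega
    simp [hN i j h1, hM i j h2]
  smul_mem' := by
    rintro c x ⟨N, hN⟩
    exact ⟨N, fun i j h => by simp [hN i j h]⟩

/-- `M_∞(A) = ⋃ N, M_N(A)`. -/
def FinMat : Type _ := finMatSubmodule A

instance : AddCommGroup (FinMat A) := inferInstanceAs (AddCommGroup (finMatSubmodule A))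

instance : Module ℂ (FinMat A) := inferInstanceAs (Module ℂ (finMatSubmodule A))

end FiniteMatrices

namespace FinMat

variable {A : Type*} [NonUnitalCStarAlgebra A]

/-- The `(i, j)` entry. -/
def coeff (x : FinMat A) (i j : ℕ) : A := x.1 i j

/-- `x` is supported in the upper left corner `N × N`, that is, `x ∈ M_N(A)`. -/
def Supp (x : FinMat A) (N : ℕ) : Prop := ∀ i j, N ≤ i ∨ N ≤ j → x.coeff i j = 0

/-- The matrix with given entries. -/
def mk (x : ℕ → ℕ → A) (N : ℕ) (h : ∀ i j, N ≤ i ∨ N ≤ j → x i j = 0) : FinMat A := ⟨x, N, h⟩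

@[simp] lemma coeff_mk (x : ℕ → ℕ → A) (N : ℕ) (h) (i j : ℕ) : (mk x N h).coeff i j = x i j := rfl
@[simp] lemma coeff_zero (i j : ℕ) : (0 : FinMat A).coeff i j = 0 := rfl
@[simp] lemma coeff_add (x y : FinMat A) (i j : ℕ) :
    (x + y).coeff i j = x.coeff i j + y.coeff i j := rfl
@[simp] lemma coeff_smul (c : ℂ) (x : FinMat A) (i j : ℕ) :
    (c • x).coeff i j = c • x.coeff i j := rfl
@[simp] lemma coeff_sub (x y : FinMat A) (i j : ℕ) :
    (x - y).coeff i j = x.coeff i j - y.coeff i j := rfl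

@[ext] lemma ext {x y : FinMat A} (h : ∀ i j, x.coeff i j = y.coeff i j) : x = y :=
  Subtype.ext (funext fun i => funext fun j => h i j)

lemma exists_supp (x : FinMat A) : ∃ N, x.Supp N := x.2

lemma Supp.mono {x : FinMat A} {N M : ℕ} (h : x.Supp N) (hNM : N ≤ M) : x.Supp M :=
  fun i j hij => h i j (by omega)

lemma exists_supp₂ (x y : FinMat A) : ∃ N, x.Supp N ∧ y.Supp N := by
  obtain ⟨N, hN⟩ := x.exists_supp
  obtain ⟨M, hM⟩ := y.exists_supp
  exact ⟨max N M, hN.mono (le_max_left _ _), hM.mono (le_max_right _ _)⟩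

lemma exists_supp₃ (x y z : FinMat A) : ∃ N, x.Supp N ∧ y.Supp N ∧ z.Supp N := by
  obtain ⟨N, hN, hN'⟩ := exists_supp₂ x y
  obtain ⟨M, hM⟩ := z.exists_supp
  exact ⟨max N M, hN.mono (le_max_left _ _), hN'.mono (le_max_left _ _),
    hM.mono (le_max_right _ _)⟩

/-- The least `N` with `x ∈ M_N(A)`. -/
def size (x : FinMat A) : ℕ := by
  classical exact Nat.find x.exists_supp

lemma supp_size (x : FinMat A) : x.Supp x.size := by
  classical exact Nat.find_spec x.exists_supp

lemma size_le {x : FinMat A} {N : ℕ} (h : x.Supp N) : x.size ≤ N := by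
  classical exact Nat.find_min' x.exists_supp h

/-- Matrix multiplication. -/
instance : Mul (FinMat A) where
  mul x y := mk (fun i j => ∑ k ∈ Finset.range x.size, x.coeff i k * y.coeff k j)
    (max x.size y.size) (by
      intro i j h
      refine Finset.sum_eq_zero fun k _ => ?_
      rcases le_total x.size i with h1 | h1
      · rw [x.supp_size i k (.inl h1), zero_mul]
      · rcases le_total y.size j with h2 | h2
        · rw [y.supp_size k j (.inr h2), mul_zero]
        · rcases h with h | h
          · rw [x.supp_size i k (.inl (by omega)), zero_mul]
          · rw [y.supp_size k j (.inr (by omega)), mul_zero])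

lemma coeff_mul {x : FinMat A} {N : ℕ} (hx : x.Supp N) (y : FinMat A) (i j : ℕ) :
    (x * y).coeff i j = ∑ k ∈ Finset.range N, x.coeff i k * y.coeff k j := by
  change ∑ k ∈ Finset.range x.size, x.coeff i k * y.coeff k j = _
  refine Finset.sum_subset (Finset.range_mono (size_le hx)) fun k _ hk => ?_
  rw [x.supp_size i k (.inr (by simpa using hk)), zero_mul]

lemma Supp.mul {x y : FinMat A} {N : ℕ} (hx : x.Supp N) (hy : y.Supp N) : (x * y).Supp N := by
  intro i j h
  rw [coeff_mul hx]
  refine Finset.sum_eq_zero fun k _ => ?_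
  rcases h with h | h
  · rw [hx i k (.inl h), zero_mul]
  · rw [hy k j (.inr h), mul_zero]

lemma Supp.add {x y : FinMat A} {N : ℕ} (hx : x.Supp N) (hy : y.Supp N) : (x + y).Supp N :=
  fun i j h => by rw [coeff_add, hx i j h, hy i j h, add_zero]

lemma Supp.smul {x : FinMat A} {N : ℕ} (c : ℂ) (hx : x.Supp N) : (c • x).Supp N :=
  fun i j h => by rw [coeff_smul, hx i j h, smul_zero]

instance : NonUnitalRing (FinMat A) where
  left_distrib x y z := by
    obtain ⟨N, hx⟩ := x.exists_supp
    ext i j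
    simp only [coeff_add, coeff_mul hx, mul_add, Finset.sum_add_distrib]
  right_distrib x y z := by
    obtain ⟨N, hx, hy⟩ := exists_supp₂ x y
    ext i j
    simp only [coeff_add, coeff_mul hx, coeff_mul hy, coeff_mul (hx.add hy), add_mul,
      Finset.sum_add_distrib]
  zero_mul x := by
    ext i j
    rw [coeff_mul (N := 0) (fun _ _ _ => rfl)]
    simp
  mul_zero x := by
    obtain ⟨N, hx⟩ := x.exists_supp
    ext i j
    simp [coeff_mul hx]
  mul_assoc x y z := by
    obtain ⟨N, hx, hy⟩ := exists_supp₂ x y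
    ext i j
    rw [coeff_mul (hx.mul hy), coeff_mul hx]
    simp only [coeff_mul hx, coeff_mul hy, Finset.sum_mul, Finset.mul_sum]
    rw [Finset.sum_comm]
    simp only [mul_assoc]

/-- The adjoint matrix `(x_{ji}^*)`. -/
instance : Star (FinMat A) where
  star x := mk (fun i j => star (x.coeff j i)) x.size fun i j h => by
    rw [x.supp_size j i h.symm, star_zero]

@[simp] lemma coeff_star (x : FinMat A) (i j : ℕ) : (star x).coeff i j = star (x.coeff j i) := rfl

lemma Supp.star {x : FinMat A} {N : ℕ} (hx : x.Supp N) : (star x).Supp N :=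
  fun i j h => by rw [coeff_star, hx j i h.symm, star_zero]

instance : StarRing (FinMat A) where
  star_involutive x := by ext; simp
  star_add x y := by ext; simp
  star_mul x y := by
    obtain ⟨N, hx, hy⟩ := exists_supp₂ x y
    ext i j
    simp [coeff_mul hx, coeff_mul hy.star]

instance : StarModule ℂ (FinMat A) where
  star_smul c x := by ext; simp

instance : IsScalarTower ℂ (FinMat A) (FinMat A) where
  smul_assoc c x y := by
    obtain ⟨N, hx⟩ := x.exists_supp
    ext i j
    simp [coeff_mul hx, coeff_mul (hx.smul c), Finset.smul_sum, smul_mul_assoc]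

instance : SMulCommClass ℂ (FinMat A) (FinMat A) where
  smul_comm c x y := by
    obtain ⟨N, hx⟩ := x.exists_supp
    ext i j
    simp [coeff_mul hx, Finset.smul_sum, mul_smul_comm]

/-- The upper left `N × N` corner of `x`, as an element of the C*-algebra `M_N(A)`. -/
def corner (N : ℕ) (x : FinMat A) : CStarMatrix (Fin N) (Fin N) A :=
  CStarMatrix.ofMatrix fun i j => x.coeff i j

@[simp] lemma corner_apply (N : ℕ) (x : FinMat A) (i j : Fin N) :
    corner N x i j = x.coeff i j := rfl

/-- The inclusion of `M_N(A)` as upper left corner. -/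
def pad {N : ℕ} (x : CStarMatrix (Fin N) (Fin N) A) : FinMat A :=
  mk (fun i j => if h : i < N ∧ j < N then x ⟨i, h.1⟩ ⟨j, h.2⟩ else 0) N
    fun i j h => dif_neg (by omega)

lemma pad_supp {N : ℕ} (x : CStarMatrix (Fin N) (Fin N) A) : (pad x).Supp N :=
  fun _ _ h => dif_neg (by omega)

lemma pad_corner {N : ℕ} {x : FinMat A} (hx : x.Supp N) : pad (corner N x) = x := by
  ext i j
  by_cases h : i < N ∧ j < N
  · simp [pad, h]
  · simp only [pad, coeff_mk, h, dite_false]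
    exact (hx i j (by omega)).symm

lemma corner_pad {N : ℕ} (x : CStarMatrix (Fin N) (Fin N) A) : corner N (pad x) = x := by
  ext i j
  simp [pad]

lemma corner_add (N : ℕ) (x y : FinMat A) : corner N (x + y) = corner N x + corner N y := rfl

lemma corner_smul (N : ℕ) (c : ℂ) (x : FinMat A) : corner N (c • x) = c • corner N x := rfl

lemma corner_star (N : ℕ) (x : FinMat A) : corner N (star x) = star (corner N x) := rfl

lemma corner_mul {N : ℕ} {x : FinMat A} (hx : x.Supp N) (y : FinMat A) :
    corner N (x * y) = corner N x * corner N y := by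
  ext i j
  rw [corner_apply, coeff_mul hx, CStarMatrix.mul_apply,
    ← Fin.sum_univ_eq_sum_range (fun k => x.coeff i k * y.coeff k j)]
  rfl

lemma corner_injOn {N : ℕ} {x y : FinMat A} (hx : x.Supp N) (hy : y.Supp N)
    (h : corner N x = corner N y) : x = y := by
  rw [← pad_corner hx, ← pad_corner hy, h]

lemma pad_add {N : ℕ} (x y : CStarMatrix (Fin N) (Fin N) A) : pad (x + y) = pad x + pad y :=
  corner_injOn (pad_supp _) ((pad_supp _).add (pad_supp _)) (by simp [corner_add, corner_pad])

lemma pad_smul {N : ℕ} (c : ℂ) (x : CStarMatrix (Fin N) (Fin N) A) : pad (c • x) = c • pad x :=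
  corner_injOn (pad_supp _) ((pad_supp _).smul c) (by simp [corner_smul, corner_pad])

lemma pad_star {N : ℕ} (x : CStarMatrix (Fin N) (Fin N) A) : pad (star x) = star (pad x) :=
  corner_injOn (pad_supp _) ((pad_supp _).star) (by simp [corner_star, corner_pad])

lemma pad_mul {N : ℕ} (x y : CStarMatrix (Fin N) (Fin N) A) : pad (x * y) = pad x * pad y :=
  corner_injOn (pad_supp _) ((pad_supp _).mul (pad_supp _))
    (by simp [corner_mul (pad_supp x), corner_pad])

/-- The C*-norm of `M_N(A)`, which is the operator norm on the Hilbert module `A ^ N`. -/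
def matNorm {N : ℕ} (x : CStarMatrix (Fin N) (Fin N) A) : ℝ :=
  letI : PartialOrder A := CStarAlgebra.spectralOrder A
  letI : StarOrderedRing A := CStarAlgebra.spectralOrderedRing A
  ‖x‖

/-- An injective *-homomorphism of `M_∞(A)` that maps `M_N(A)` to `M_M(A)` is isometric there. -/
lemma matNorm_map (φ : FinMat A →⋆ₙₐ[ℂ] FinMat A) (hφ : Function.Injective φ) {N M : ℕ}
    (h : ∀ x : FinMat A, x.Supp N → (φ x).Supp M) {x : FinMat A} (hx : x.Supp N) :
    matNorm (corner M (φ x)) = matNorm (corner N x) := by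
  let _ : PartialOrder A := CStarAlgebra.spectralOrder A
  let _ : StarOrderedRing A := CStarAlgebra.spectralOrderedRing A
  let ψ : CStarMatrix (Fin N) (Fin N) A →⋆ₙₐ[ℂ] CStarMatrix (Fin M) (Fin M) A :=
    { toFun := fun y => corner M (φ (pad y))
      map_smul' := fun c y => by simp [pad_smul, corner_smul]
      map_zero' := by
        have : pad (0 : CStarMatrix (Fin N) (Fin N) A) = 0 := by
          simpa using pad_smul 0 (0 : CStarMatrix (Fin N) (Fin N) A)
        rw [this, map_zero]
        rfl
      map_add' := fun y z => by simp [pad_add, corner_add]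
      map_mul' := fun y z => by
        rw [pad_mul, map_mul, corner_mul (h _ (pad_supp y))]
      map_star' := fun y => by simp [pad_star, corner_star, map_star] }
  have hψ : Function.Injective ψ := fun y z hyz => by
    have h1 := hφ (corner_injOn (h _ (pad_supp y)) (h _ (pad_supp z)) hyz)
    rw [← corner_pad y, ← corner_pad z, h1]
  have := NonUnitalStarAlgHom.norm_map ψ hψ (corner N x)
  change ‖corner M (φ x)‖ = ‖corner N x‖
  rw [← this]
  change _ = ‖corner M (φ (pad (corner N x)))‖
  rw [pad_corner hx]

/-- The norm of `x` in `M_N(A)`, for any `N` with `x ∈ M_N(A)`. -/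
instance : Norm (FinMat A) where
  norm x := matNorm (corner x.size x)

lemma norm_eq {x : FinMat A} {N : ℕ} (hx : x.Supp N) : ‖x‖ = matNorm (corner N x) :=
  (matNorm_map (NonUnitalStarAlgHom.id ℂ (FinMat A)) Function.injective_id
    (fun _ hy => Supp.mono hy (size_le hx)) x.supp_size).symm

/-- The norms of `M_N(A)` make `M_∞(A)` a normed space. -/
lemma normedSpaceCore : NormedSpace.Core ℂ (FinMat A) := by
  let _ : PartialOrder A := CStarAlgebra.spectralOrder A
  let _ : StarOrderedRing A := CStarAlgebra.spectralOrderedRing A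
  refine { norm_nonneg := fun x => norm_nonneg (corner x.size x), norm_smul := fun c x => ?_,
           norm_triangle := fun x y => ?_, norm_eq_zero_iff := fun x => ?_ }
  · rw [norm_eq (x.supp_size.smul c), corner_smul]
    exact norm_smul c (corner x.size x)
  · obtain ⟨N, hx, hy⟩ := exists_supp₂ x y
    rw [norm_eq (hx.add hy), norm_eq hx, norm_eq hy, corner_add]
    exact norm_add_le (corner N x) (corner N y)
  · constructor
    · intro h
      have h' : corner x.size x = 0 := norm_eq_zero.mp h
      exact corner_injOn x.supp_size (fun _ _ _ => rfl) h'
    · rintro rfl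
      exact norm_zero (E := CStarMatrix (Fin (size (0 : FinMat A))) (Fin (size (0 : FinMat A))) A)

instance : NormedAddCommGroup (FinMat A) := .ofCore normedSpaceCore

instance : NormedSpace ℂ (FinMat A) := .ofCore normedSpaceCore

lemma norm_mul_le' (x y : FinMat A) : ‖x * y‖ ≤ ‖x‖ * ‖y‖ := by
  let _ : PartialOrder A := CStarAlgebra.spectralOrder A
  let _ : StarOrderedRing A := CStarAlgebra.spectralOrderedRing A
  obtain ⟨N, hx, hy⟩ := exists_supp₂ x y
  rw [norm_eq (hx.mul hy), norm_eq hx, norm_eq hy, corner_mul hx]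
  exact norm_mul_le (corner N x) (corner N y)

instance : NonUnitalNormedRing (FinMat A) where
  __ := (inferInstance : NormedAddCommGroup (FinMat A))
  __ := (inferInstance : NonUnitalRing (FinMat A))
  norm_mul_le := norm_mul_le'

instance : CStarRing (FinMat A) where
  norm_mul_self_le x := by
    let _ : PartialOrder A := CStarAlgebra.spectralOrder A
    let _ : StarOrderedRing A := CStarAlgebra.spectralOrderedRing A
    have hx := x.supp_size
    rw [norm_eq hx, norm_eq (hx.star.mul hx), corner_mul hx.star, corner_star]
    exact CStarRing.norm_mul_self_le (corner x.size x)

lemma norm_coeff_le (x : FinMat A) (i j : ℕ) : ‖x.coeff i j‖ ≤ ‖x‖ := by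
  let _ : PartialOrder A := CStarAlgebra.spectralOrder A
  let _ : StarOrderedRing A := CStarAlgebra.spectralOrderedRing A
  have hx : x.Supp (max x.size (max i j + 1)) := x.supp_size.mono (le_max_left _ _)
  rw [norm_eq hx]
  exact CStarMatrix.norm_entry_le_norm (M := corner _ x) (i := ⟨i, by omega⟩) (j := ⟨j, by omega⟩)

/-- The matrix with `a` in the upper left corner and zeros elsewhere. -/
def single (a : A) : FinMat A :=
  mk (fun i j => if i = 0 ∧ j = 0 then a else 0) 1 fun i j h => if_neg (by omega)

lemma single_star_mul (a : A) : single (star a * a) = star (single a) * single a := by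
  have h : (star (single a)).Supp 1 :=
    Supp.star (fun i j h => if_neg (by omega) : (single a).Supp 1)
  ext i j
  rw [coeff_mul h]
  by_cases hi : i = 0 <;> by_cases hj : j = 0 <;> simp [single, hi, hj]

/-- For `r = 0, 1`, the map `x ↦ w x w^*` where `w` is the isometry with `w e_n = e_{2 n + r}`. -/
def spreadFun (r : Fin 2) (x : FinMat A) : FinMat A :=
  mk (fun i j => if i % 2 = r ∧ j % 2 = r then x.coeff (i / 2) (j / 2) else 0) (2 * x.size)
    fun i j h => by
      split_ifs
      · exact x.supp_size _ _ (by omega)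
      · rfl

lemma coeff_spreadFun (r : Fin 2) (x : FinMat A) (i j : ℕ) : (spreadFun r x).coeff i j =
    if i % 2 = r ∧ j % 2 = r then x.coeff (i / 2) (j / 2) else 0 := rfl

lemma Supp.spreadFun {x : FinMat A} {N : ℕ} (hx : x.Supp N) (r : Fin 2) :
    (spreadFun r x).Supp (2 * N) := fun i j h => by
  rw [coeff_spreadFun]
  split_ifs
  · exact hx _ _ (by omega)
  · rfl

lemma sum_spread (r : Fin 2) (f : ℕ → A) (N : ℕ) :
    ∑ k ∈ Finset.range (2 * N), (if k % 2 = (r : ℕ) then f (k / 2) else 0) =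
      ∑ k ∈ Finset.range N, f k := by
  induction N with
  | zero => simp
  | succ n ih =>
    rw [show 2 * (n + 1) = 2 * n + 1 + 1 by ring, Finset.sum_range_succ, Finset.sum_range_succ, ih,
      Finset.sum_range_succ]
    have h1 : (2 * n + 1) / 2 = n := by omega
    have h2 : (2 * n) / 2 = n := by omega
    fin_cases r <;> simp [h1, h2, Nat.add_mod]

/-- The *-homomorphism `x ↦ w x w^*` of `M_∞(A)`. -/
def spread (r : Fin 2) : FinMat A →⋆ₙₐ[ℂ] FinMat A where
  toFun := spreadFun r
  map_smul' c x := by ext i j; simp [coeff_spreadFun]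
  map_zero' := by ext i j; simp [coeff_spreadFun]
  map_add' x y := by
    ext i j
    simp only [coeff_spreadFun, coeff_add]
    split_ifs <;> simp
  map_mul' x y := by
    obtain ⟨N, hx, hy⟩ := exists_supp₂ x y
    ext i j
    rw [coeff_mul (hx.spreadFun r), coeff_spreadFun, coeff_mul hx,
      ← sum_spread r (fun k => x.coeff (i / 2) k * y.coeff k (j / 2))]
    simp only [coeff_spreadFun]
    split_ifs with h
    · refine Finset.sum_congr rfl fun k _ => ?_
      by_cases hk : k % 2 = (r : ℕ) <;> simp [h, hk]
    · refine (Finset.sum_eq_zero fun k _ => ?_).symm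
      by_cases hi : i % 2 = (r : ℕ)
      · have hj : ¬ j % 2 = (r : ℕ) := fun hj => h ⟨hi, hj⟩
        simp [hj]
      · simp [hi]
  map_star' x := by
    ext i j
    simp only [coeff_spreadFun, coeff_star, and_comm (a := i % 2 = (r : ℕ))]
    split_ifs <;> simp

lemma spread_injective (r : Fin 2) : Function.Injective (spread r : FinMat A →⋆ₙₐ[ℂ] FinMat A) := by
  intro x y h
  ext i j
  have h' := congrArg (fun z : FinMat A => z.coeff (2 * i + r) (2 * j + r)) h
  change (spreadFun r x).coeff _ _ = (spreadFun r y).coeff _ _ at h'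
  have hr : (r : ℕ) < 2 := r.2
  have e1 : (2 * i + (r : ℕ)) % 2 = r := by omega
  have e2 : (2 * j + (r : ℕ)) % 2 = r := by omega
  have e3 : (2 * i + (r : ℕ)) / 2 = i := by omega
  have e4 : (2 * j + (r : ℕ)) / 2 = j := by omega
  simpa only [coeff_spreadFun, e1, e2, e3, e4, and_self, if_true] using h'

lemma norm_spread (r : Fin 2) (x : FinMat A) : ‖spread r x‖ = ‖x‖ := by
  have h : (spread r x).Supp (2 * x.size) := x.supp_size.spreadFun r
  rw [norm_eq h, norm_eq x.supp_size]
  exact matNorm_map (spread r) (spread_injective r) (fun y hy => hy.spreadFun r) x.supp_size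

lemma spread_isometry (r : Fin 2) : Isometry (spread r : FinMat A →⋆ₙₐ[ℂ] FinMat A) :=
  AddMonoidHomClass.isometry_of_norm _ (norm_spread r)

lemma spread_mul_spread {r s : Fin 2} (hrs : r ≠ s) (x y : FinMat A) :
    spread r x * spread s y = 0 := by
  ext i j
  have h : (spread r x).Supp (2 * x.size) := x.supp_size.spreadFun r
  rw [coeff_mul h]
  refine Finset.sum_eq_zero fun k _ => ?_
  change (spreadFun r x).coeff _ _ * (spreadFun s y).coeff _ _ = 0
  rw [coeff_spreadFun, coeff_spreadFun]
  by_cases hk : k % 2 = (r : ℕ)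
  · have : ¬ k % 2 = (s : ℕ) := fun h => hrs (Fin.ext (hk.symm.trans h))
    simp [this]
  · simp [hk]

end FinMat

/-- The stabilization `A ⊗ K`, with `K` the compact operators on a separable infinite-dimensional
Hilbert space: the completion of `M_∞(A)`. -/
def Stab (A : Type*) [NonUnitalCStarAlgebra A] : Type _ := Completion (FinMat A)

namespace Stab

variable {A : Type*} [NonUnitalCStarAlgebra A]

instance : NormedAddCommGroup (Stab A) :=
  inferInstanceAs (NormedAddCommGroup (Completion (FinMat A)))

instance : NormedSpace ℂ (Stab A) := inferInstanceAs (NormedSpace ℂ (Completion (FinMat A)))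

instance : CompleteSpace (Stab A) := inferInstanceAs (CompleteSpace (Completion (FinMat A)))

/-- The inclusion of `M_∞(A)`. -/
def of (x : FinMat A) : Stab A := (x : Completion (FinMat A))

lemma continuous_of : Continuous (of : FinMat A → Stab A) := Completion.continuous_coe _

lemma isDenseInducing_of : IsDenseInducing (of : FinMat A → Stab A) :=
  Completion.isDenseInducing_coe

@[simp] lemma norm_of (x : FinMat A) : ‖of x‖ = ‖x‖ := Completion.norm_coe x
lemma of_add (x y : FinMat A) : of (x + y) = of x + of y := Completion.coe_add x y
lemma of_smul (c : ℂ) (x : FinMat A) : of (c • x) = c • of x := Completion.coe_smul c x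
lemma of_zero : of (0 : FinMat A) = 0 := rfl

@[elab_as_elim] lemma induction₁ {p : Stab A → Prop} (x : Stab A) (hp : IsClosed {x | p x})
    (h : ∀ x, p (of x)) : p x := Completion.induction_on x hp h

@[elab_as_elim] lemma induction₂ {p : Stab A → Stab A → Prop} (x y : Stab A)
    (hp : IsClosed {x : Stab A × Stab A | p x.1 x.2}) (h : ∀ x y, p (of x) (of y)) : p x y :=
  Completion.induction_on₂ x y hp h

@[elab_as_elim] lemma induction₃ {p : Stab A → Stab A → Stab A → Prop} (x y z : Stab A)
    (hp : IsClosed {x : Stab A × Stab A × Stab A | p x.1 x.2.1 x.2.2})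
    (h : ∀ x y z, p (of x) (of y) (of z)) : p x y z :=
  Completion.induction_on₃ x y z hp h

/-- The multiplication of `M_∞(A)`, extended by continuity. -/
instance : Mul (Stab A) where
  mul x y := (isDenseInducing_of.prodMap isDenseInducing_of).extend
    (fun p : FinMat A × FinMat A => of (p.1 * p.2)) (x, y)

lemma of_mul (x y : FinMat A) : of (x * y) = of x * of y :=
  ((isDenseInducing_of.prodMap isDenseInducing_of).extend_eq
    (continuous_of.comp (continuous_fst.mul continuous_snd)) (x, y)).symm

instance : ContinuousMul (Stab A) where
  continuous_mul := by
    let m := (AddMonoidHom.mul : FinMat A →+ FinMat A →+ FinMat A).compr₂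
      (Completion.toCompl : FinMat A →+ Completion (FinMat A))
    have : Continuous fun p : FinMat A × FinMat A => m p.1 p.2 :=
      continuous_of.comp continuous_mul
    have di : IsDenseInducing (Completion.toCompl : FinMat A → Completion (FinMat A)) :=
      Completion.isDenseInducing_coe
    exact (di.extend_Z_bilin di this :)

/-- The involution of `M_∞(A)`, extended by continuity. -/
instance : Star (Stab A) where
  star x := Completion.map (star : FinMat A → FinMat A) x

lemma of_star (x : FinMat A) : of (star x) = star (of x) :=
  (Completion.map_coe star_isometry.uniformContinuous x).symm

lemma continuous_star' : Continuous (star : Stab A → Stab A) := Completion.continuous_map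

instance : NonUnitalNormedRing (Stab A) where
  __ := (inferInstance : NormedAddCommGroup (Stab A))
  __ := (inferInstance : Mul (Stab A))
  left_distrib x y z := by
    refine induction₃ x y z (isClosed_eq (by fun_prop) (by fun_prop)) fun x y z => ?_
    simp only [← of_add, ← of_mul, mul_add]
  right_distrib x y z := by
    refine induction₃ x y z (isClosed_eq (by fun_prop) (by fun_prop)) fun x y z => ?_
    simp only [← of_add, ← of_mul, add_mul]
  zero_mul x := by
    refine induction₁ x (isClosed_eq (by fun_prop) (by fun_prop)) fun x => ?_
    rw [← of_zero, ← of_mul, zero_mul]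
  mul_zero x := by
    refine induction₁ x (isClosed_eq (by fun_prop) (by fun_prop)) fun x => ?_
    rw [← of_zero, ← of_mul, mul_zero]
  mul_assoc x y z := by
    refine induction₃ x y z (isClosed_eq (by fun_prop) (by fun_prop)) fun x y z => ?_
    simp only [← of_mul, mul_assoc]
  norm_mul_le x y := by
    refine induction₂ x y (isClosed_le (by fun_prop) (by fun_prop)) fun x y => ?_
    rw [← of_mul, norm_of, norm_of, norm_of]
    exact norm_mul_le x y

instance : StarRing (Stab A) where
  star_involutive x := by
    refine induction₁ x (isClosed_eq (continuous_star'.comp continuous_star') continuous_id)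
      fun x => ?_
    simp only [← of_star, star_star]
  star_add x y := by
    refine induction₂ x y (isClosed_eq (continuous_star'.comp continuous_add)
      ((continuous_star'.comp continuous_fst).add (continuous_star'.comp continuous_snd)))
      fun x y => ?_
    simp only [← of_add, ← of_star, star_add]
  star_mul x y := by
    refine induction₂ x y (isClosed_eq (continuous_star'.comp continuous_mul)
      ((continuous_star'.comp continuous_snd).mul (continuous_star'.comp continuous_fst)))
      fun x y => ?_
    simp only [← of_mul, ← of_star, star_mul]

/-- `A ⊗ K` is a C*-algebra. -/
instance : NonUnitalCStarAlgebra (Stab A) where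
  __ := (inferInstance : NonUnitalNormedRing (Stab A))
  __ := (inferInstance : StarRing (Stab A))
  __ := (inferInstance : NormedSpace ℂ (Stab A))
  __ := (inferInstance : CompleteSpace (Stab A))
  norm_mul_self_le x := by
    refine induction₁ x (isClosed_le (by fun_prop)
      (continuous_norm.comp (continuous_star'.mul continuous_id))) fun x => ?_
    rw [← of_star, ← of_mul, norm_of, norm_of]
    exact CStarRing.norm_mul_self_le x
  smul_assoc c x y := by
    refine induction₂ x y (isClosed_eq ((continuous_fst.const_smul c).mul continuous_snd)
      ((continuous_fst.mul continuous_snd).const_smul c)) fun x y => ?_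
    simp only [smul_eq_mul, ← of_smul, ← of_mul, smul_mul_assoc]
  smul_comm c x y := by
    refine induction₂ x y (isClosed_eq ((continuous_fst.mul continuous_snd).const_smul c)
      (continuous_fst.mul (continuous_snd.const_smul c))) fun x y => ?_
    simp only [smul_eq_mul, ← of_smul, ← of_mul, mul_smul_comm]
  star_smul c x := by
    refine induction₁ x (isClosed_eq (continuous_star'.comp (continuous_const_smul c))
      (continuous_star'.const_smul (star c))) fun x => ?_
    simp only [← of_smul, ← of_star, star_smul]

/-- The `(i, j)` matrix entry of an element of `A ⊗ K`. -/
def entry (i j : ℕ) (x : Stab A) : A := Completion.extension (fun y : FinMat A => y.coeff i j) x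

lemma uniformContinuous_coeff (i j : ℕ) :
    UniformContinuous (fun y : FinMat A => y.coeff i j) := by
  refine LipschitzWith.uniformContinuous (K := 1) (LipschitzWith.of_dist_le_mul fun x y => ?_)
  rw [dist_eq_norm, dist_eq_norm, ← FinMat.coeff_sub, NNReal.coe_one, one_mul]
  exact FinMat.norm_coeff_le _ i j

lemma continuous_entry (i j : ℕ) : Continuous (entry i j : Stab A → A) :=
  Completion.continuous_extension

@[simp] lemma entry_of (i j : ℕ) (x : FinMat A) : entry i j (of x) = x.coeff i j :=
  Completion.extension_coe (uniformContinuous_coeff i j) x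

/-- `a ⊗ e_{00}`. -/
def single (a : A) : Stab A := of (FinMat.single a)

/-- For `r = 0, 1`, the map `x ↦ w x w^*` of `A ⊗ K`, where `w` is the isometry with
`w e_n = e_{2 n + r}`. The two isometries have orthogonal ranges, with sum the whole space. -/
def spread (r : Fin 2) (x : Stab A) : Stab A :=
  Completion.map (FinMat.spread r : FinMat A → FinMat A) x

lemma continuous_spread (r : Fin 2) : Continuous (spread r : Stab A → Stab A) :=
  Completion.continuous_map

lemma spread_of (r : Fin 2) (x : FinMat A) : spread r (of x) = of (FinMat.spread r x) :=
  Completion.map_coe (FinMat.spread_isometry r).uniformContinuous x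

lemma spread_mul (r : Fin 2) (x y : Stab A) : spread r (x * y) = spread r x * spread r y := by
  refine induction₂ x y (isClosed_eq ((continuous_spread r).comp continuous_mul)
    (((continuous_spread r).comp continuous_fst).mul ((continuous_spread r).comp continuous_snd)))
    fun x y => ?_
  simp only [← of_mul, spread_of, map_mul]

lemma spread_star (r : Fin 2) (x : Stab A) : spread r (star x) = star (spread r x) := by
  refine induction₁ x (isClosed_eq ((continuous_spread r).comp continuous_star)
    (continuous_star.comp (continuous_spread r))) fun x => ?_
  simp only [← of_star, spread_of, map_star]

lemma spread_mul_spread {r s : Fin 2} (hrs : r ≠ s) (x y : Stab A) :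
    spread r x * spread s y = 0 := by
  refine induction₂ x y (isClosed_eq (((continuous_spread r).comp continuous_fst).mul
    ((continuous_spread s).comp continuous_snd)) continuous_const) fun x y => ?_
  rw [spread_of, spread_of, ← of_mul, FinMat.spread_mul_spread hrs, of_zero]

/-- `Θ(diag(x, y))`, where `Θ : M_2(A ⊗ K) → A ⊗ K` is the inner isomorphism
`Θ((x_{rs})) = ∑ w_r x_{rs} w_s^*`. -/
def dsum (x y : Stab A) : Stab A := spread 0 x + spread 1 y

lemma dsum_mul (x y x' y' : Stab A) : dsum x y * dsum x' y' = dsum (x * x') (y * y') := by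
  simp [dsum, mul_add, add_mul, spread_mul, spread_mul_spread]

lemma dsum_star (x y : Stab A) : star (dsum x y) = dsum (star x) (star y) := by
  simp [dsum, spread_star]

end Stab

/-- `A` is stable if `A ≅ A ⊗ K`. -/
def IsStable (A : Type*) [NonUnitalCStarAlgebra A] : Prop := Nonempty (A ≃⋆ₐ[ℂ] Stab A)

/-! ## Cuntz comparison and the Cuntz semigroup -/

section Comparison

variable {B : Type*} [NonUnitalCStarAlgebra B]

/-- Positivity in a C*-algebra. -/
def IsPos (b : B) : Prop := ∃ y : B, b = star y * y

/-- Cuntz subequivalence. -/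
def CuntzLE (a b : B) : Prop := ∃ x : ℕ → B, Tendsto (fun n => x n * b * star (x n)) atTop (𝓝 a)

lemma cuntzLE_iff {a b : B} :
    CuntzLE a b ↔ ∀ ε > 0, ∃ x : B, dist (x * b * star x) a < ε := by
  constructor
  · rintro ⟨x, hx⟩ ε hε
    obtain ⟨n, hn⟩ := ((Metric.tendsto_nhds.mp hx) ε hε).exists
    exact ⟨x n, hn⟩
  · intro h
    choose x hx using fun n : ℕ => h (1 / ((n : ℝ) + 1)) (by positivity)
    refine ⟨x, tendsto_iff_dist_tendsto_zero.mpr ?_⟩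
    exact squeeze_zero (fun _ => dist_nonneg) (fun n => (hx n).le)
      tendsto_one_div_add_atTop_nhds_zero_nat

lemma CuntzLE.refl (a : B) : CuntzLE a a := by
  let _ : PartialOrder B := CStarAlgebra.spectralOrder B
  let _ : StarOrderedRing B := CStarAlgebra.spectralOrderedRing B
  rw [cuntzLE_iff]
  intro ε hε
  have hu := CStarAlgebra.increasingApproximateUnit B
  have h1 : Tendsto (fun u : B => u * a * star u) (CStarAlgebra.approximateUnit B) (𝓝 a) := by
    have hr : Tendsto (fun u : B => a * u) (CStarAlgebra.approximateUnit B) (𝓝 a) :=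
      hu.tendsto_mul_left a
    have hl : Tendsto (fun u : B => u * a) (CStarAlgebra.approximateUnit B) (𝓝 a) :=
      hu.tendsto_mul_right a
    have h2 : Tendsto (fun u : B => u * (a * u - a) + u * a)
        (CStarAlgebra.approximateUnit B) (𝓝 (0 + a)) := by
      refine Tendsto.add ?_ hl
      have h3 : Tendsto (fun u : B => ‖a * u - a‖) (CStarAlgebra.approximateUnit B) (𝓝 0) :=
        tendsto_iff_norm_sub_tendsto_zero.mp hr
      refine squeeze_zero_norm' ?_ h3
      filter_upwards [hu.eventually_norm] with u hu1
      exact (norm_mul_le _ _).trans (mul_le_of_le_one_left (norm_nonneg _) hu1)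
    rw [zero_add] at h2
    refine h2.congr' ?_
    filter_upwards [hu.eventually_star_eq] with u hu2
    rw [hu2, mul_sub, mul_assoc]
    abel
  obtain ⟨u, hu⟩ := ((Metric.tendsto_nhds.mp h1) ε hε).exists
  exact ⟨u, hu⟩

lemma CuntzLE.trans {a b c : B} (hab : CuntzLE a b) (hbc : CuntzLE b c) : CuntzLE a c := by
  rw [cuntzLE_iff] at hab ⊢
  obtain ⟨y, hy⟩ := hbc
  intro ε hε
  obtain ⟨x, hx⟩ := hab ε hε
  have h : Tendsto (fun n => (x * y n) * c * star (x * y n)) atTop (𝓝 (x * b * star x)) := by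
    have := (hy.const_mul x).mul_const (star x)
    simpa only [star_mul, mul_assoc] using this
  have h' := (h.dist (tendsto_const_nhds (x := a))).eventually_lt_const hx
  obtain ⟨n, hn⟩ := h'.exists
  exact ⟨_, hn⟩

end Comparison

lemma IsPos.dsum {A : Type*} [NonUnitalCStarAlgebra A] {a b : Stab A} (ha : IsPos a)
    (hb : IsPos b) : IsPos (Stab.dsum a b) := by
  obtain ⟨x, rfl⟩ := ha
  obtain ⟨y, rfl⟩ := hb
  exact ⟨Stab.dsum x y, by rw [Stab.dsum_star, Stab.dsum_mul]⟩

lemma CuntzLE.dsum {A : Type*} [NonUnitalCStarAlgebra A] {a b a' b' : Stab A}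
    (h : CuntzLE a a') (h' : CuntzLE b b') : CuntzLE (Stab.dsum a b) (Stab.dsum a' b') := by
  obtain ⟨x, hx⟩ := h
  obtain ⟨y, hy⟩ := h'
  refine ⟨fun n => Stab.dsum (x n) (y n), ?_⟩
  simp only [Stab.dsum_star, Stab.dsum_mul]
  exact (((Stab.continuous_spread 0).tendsto _).comp hx).add
    (((Stab.continuous_spread 1).tendsto _).comp hy)

lemma IsPos.single {A : Type*} [NonUnitalCStarAlgebra A] {a : A} (ha : IsPos a) :
    IsPos (Stab.single a) := by
  obtain ⟨x, rfl⟩ := ha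
  exact ⟨Stab.single x, by
    rw [Stab.single, Stab.single, FinMat.single_star_mul, Stab.of_mul, Stab.of_star]⟩

/-- Cuntz equivalence on `(A ⊗ K)_+`. -/
def cuntzSetoid (A : Type*) [NonUnitalCStarAlgebra A] : Setoid {a : Stab A // IsPos a} where
  r a b := CuntzLE a.1 b.1 ∧ CuntzLE b.1 a.1
  iseqv := ⟨fun a => ⟨.refl a.1, .refl a.1⟩, fun h => ⟨h.2, h.1⟩,
    fun h h' => ⟨h.1.trans h'.1, h'.2.trans h.2⟩⟩

/-- The Cuntz semigroup `Cu(A) = (A ⊗ K)_+ / ∼`. -/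
def Cu (A : Type*) [NonUnitalCStarAlgebra A] : Type _ := Quotient (cuntzSetoid A)

namespace Cu

variable {A : Type*} [NonUnitalCStarAlgebra A]

/-- The class of a positive element of `A ⊗ K`. -/
def mk (a : Stab A) (ha : IsPos a) : Cu A := Quotient.mk (cuntzSetoid A) ⟨a, ha⟩

/-- The class `[a] = [a ⊗ e_{00}]` of a positive element of `A`. -/
def cls (a : A) (ha : IsPos a) : Cu A := mk (Stab.single a) ha.single

/-- The order induced by Cuntz subequivalence. -/
instance : PartialOrder (Cu A) where
  le := Quotient.lift₂ (fun a b => CuntzLE a.1 b.1) fun _ _ _ _ h h' =>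
    propext ⟨fun H => (h.2.trans H).trans h'.1, fun H => (h.1.trans H).trans h'.2⟩
  le_refl := by rintro ⟨a⟩; exact CuntzLE.refl a.1
  le_trans := by rintro ⟨a⟩ ⟨b⟩ ⟨c⟩ h h'; exact CuntzLE.trans h h'
  le_antisymm := by rintro ⟨a⟩ ⟨b⟩ h h'; exact Quotient.sound ⟨h, h'⟩

/-- The addition `[a] + [b] = [Θ(diag(a, b))]`. -/
instance : Add (Cu A) where
  add := Quotient.map₂ (fun a b => ⟨Stab.dsum a.1 b.1, a.2.dsum b.2⟩)
    fun _ _ h _ _ h' => ⟨h.1.dsum h'.1, h.2.dsum h'.2⟩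

end Cu

/-! ## Bimorphisms -/

/-- `s ≪ t`: whenever `t ≤ sup z_n` for an increasing sequence `z` which has a supremum, there is
`m` with `s ≤ z_m`. -/
def CompactlyContained {S : Type*} [PartialOrder S] (s t : S) : Prop :=
  ∀ z : ℕ → S, Monotone z → ∀ w, IsLUB (Set.range z) w → t ≤ w → ∃ m, s ≤ z m

/-- A map of ordered semigroups that preserves order, addition and suprema of increasing
sequences. -/
structure PreservesCuStructure {S T : Type*} [PartialOrder S] [Add S] [PartialOrder T] [Add T]
    (f : S → T) : Prop where
  monotone : Monotone f
  map_add : ∀ s s', f (s + s') = f s + f s'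
  map_sup : ∀ (z : ℕ → S) (w : S), Monotone z → IsLUB (Set.range z) w →
    IsLUB (Set.range fun n => f (z n)) (f w)

/-- `≪`-bimorphisms. -/
structure IsBimorphism {S T R : Type*} [PartialOrder S] [Add S] [PartialOrder T] [Add T]
    [PartialOrder R] [Add R] (φ : S → T → R) : Prop where
  right : ∀ s, PreservesCuStructure fun t => φ s t
  left : ∀ t, PreservesCuStructure fun s => φ s t
  compactlyContained : ∀ s' s t' t, CompactlyContained s' s → CompactlyContained t' t →
    CompactlyContained (φ s' t') (φ s t)

/-- The product `m a` of a multiplier `m ∈ M(A)` and `a ∈ A`. -/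
def mulAct {A : Type*} [NonUnitalCStarAlgebra A] (m : 𝓜(ℂ, A)) (a : A) : A := m.fst a

end CuntzAction

end

open CuntzAction

/-!
Let `C = C(X)`. A matrix `F` over `C` and `a ∈ A` have the product `F · a = (θ(F_{ij}) a)`. Since `θ`
is central, `(F · a) (G · b) = (F G) · (a b)` and `(F · a)^* = F^* · a^*`, and since
`‖F‖² 1 - F^* F = G^* G` for some `G`, also `‖F · a‖ ≤ ‖F‖ ‖a‖`. The product therefore extends to
`F ∈ C ⊗ K` (`Stab.act`), and it preserves positivity and Cuntz comparison: if `x_n F' x_n^* → F` and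
`y_n a' y_n^* → a`, then `x_n · y_n` transforms `F' · a'` to `F · a` in the limit (`CuntzLE.act`).

Because `A` is stable, `M(A)` contains isometries `s_0, s_1, …` with orthogonal ranges. For
`y ∈ A ⊗ K` the row `(s_0, s_1, …) y` lies in the first row, so that `y^* y` is Cuntz equivalent to an
element of the corner `A = A ⊗ e_{00}`. Thus every class in `Cu A` is some `[a]` with `a ∈ A`
(`IsStable.exists_cls`), and comparison in the corner is the same as in `A ⊗ K`
(`cuntzLE_of_single`). So `([F], [a]) ↦ [F · a]` is a well defined map on `Cu C × Cu A` (`action`).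
An element of `A ⊗ K` is determined by its entries (`Stab.ext_entry`), so it is the only map with the
required values.

The properties of a bimorphism follow from Rørdam's description of the order by the cut-downs
`(a - ε)_+`.

* `[(a - ε)_+] ≪ [a]`, and everything compactly contained in `[a]` is below some `[(a - ε)_+]`
  (`compactlyContained_cut`, `exists_le_cut_of_compactlyContained`). The first fact needs that an
  increasing sequence `[z_n]` has an upper bound `[w]` such that each `(w - ε)_+` is below some `z_n`
  (`exists_bound`). To construct `w`, each `z_n` is cut down to `y_n` and moved by a unitary multiplier
  into the hereditary subalgebra of `y_{n+1}`; a weighted sum of the moved elements is the bound. The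
  unitary is the Halmos dilation of a contraction that carries `y_n` there
  (`CuntzPair.exists_unitary`, `exists_contraction`).
* Suprema are preserved in each variable, because `F · a` is the limit of `F · (a - ε)_+` and of
  `(F - ε)_+ · a`, and elements below a fixed class form a closed set.
* Additivity in `F` is clear from the entries. For additivity in `a` the summands are replaced by
  orthogonal elements of `A`, whose products with `F` stay orthogonal (`action_add_right`).
* `≪` is preserved since `(F - ε)_+ · (a - ε)_+ ≾ (F · a - δ)_+` for small `δ`
  (`exists_cuntzLE_cut_act`): for suitable `x` the element `x (F · a) x^*` acts as a unit on the left
  hand side.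
-/

namespace CuntzAction

/-! ### Functional calculus of a positive element -/

section FunctionalCalculus

variable {B : Type*} [NonUnitalCStarAlgebra B]

/-- `(a - ε)_+`, for `0 ≤ ε`. For `ε < 0` the function does not vanish at `0`, and the value is the
junk value of the non-unital functional calculus. -/
noncomputable def cut (ε : ℝ) (a : B) : B := cfcₙ (fun t : ℝ => max (t - ε) 0) a

/-- The square root, defined by the real functional calculus. -/
noncomputable def root (a : B) : B := cfcₙ Real.sqrt a

lemma star_cfcₙ_real (f : ℝ → ℝ) (a : B) : star (cfcₙ f a) = cfcₙ f a := by
  rw [← cfcₙ_star]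
  simp

lemma star_root (a : B) : star (root a) = root a := star_cfcₙ_real _ a

lemma star_cut (ε : ℝ) (a : B) : star (cut ε a) = cut ε a := star_cfcₙ_real _ a

lemma cfcₙ_mul_cfcₙ {f g : ℝ → ℝ} (hf : Continuous f) (hf0 : f 0 = 0) (hg : Continuous g)
    (hg0 : g 0 = 0) (a : B) : cfcₙ f a * cfcₙ g a = cfcₙ (fun t => f t * g t) a :=
  (cfcₙ_mul f g a hf.continuousOn hf0 hg.continuousOn hg0).symm

variable [PartialOrder B] [StarOrderedRing B] {a b : B}

lemma isPos_iff : IsPos a ↔ 0 ≤ a := CStarAlgebra.nonneg_iff_eq_star_mul_self.symm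

lemma cfcₙ_congr_nonneg (ha : 0 ≤ a) {f g : ℝ → ℝ} (h : ∀ t, 0 ≤ t → f t = g t) :
    cfcₙ f a = cfcₙ g a :=
  cfcₙ_congr fun t ht => h t (quasispectrum_nonneg_of_nonneg a ha t ht)

lemma norm_cfcₙ_sub_le (ha : 0 ≤ a) {f g : ℝ → ℝ} (hf : Continuous f) (hf0 : f 0 = 0)
    (hg : Continuous g) (hg0 : g 0 = 0) {C : ℝ} (h : ∀ t, 0 ≤ t → |f t - g t| ≤ C) :
    ‖cfcₙ f a - cfcₙ g a‖ ≤ C := by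
  rw [← cfcₙ_sub f g a hf.continuousOn hf0 hg.continuousOn hg0]
  exact norm_cfcₙ_le fun t ht => h t (quasispectrum_nonneg_of_nonneg a ha t ht)

lemma continuous_cutFun (ε : ℝ) : Continuous fun t : ℝ => max (t - ε) 0 := by fun_prop

lemma cutFun_zero {ε : ℝ} (hε : 0 ≤ ε) : max ((0 : ℝ) - ε) 0 = 0 := by simp [hε]

lemma cut_nonneg (ε : ℝ) (a : B) : 0 ≤ cut ε a := cfcₙ_nonneg fun _ _ => le_max_right _ _

lemma root_mul_root (ha : 0 ≤ a) : root a * root a = a := by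
  rw [root, cfcₙ_mul_cfcₙ Real.continuous_sqrt Real.sqrt_zero Real.continuous_sqrt Real.sqrt_zero,
    cfcₙ_congr_nonneg ha (g := fun t => t) fun t ht => Real.mul_self_sqrt ht]
  exact cfcₙ_id' ℝ a

lemma norm_cut_sub_le {ε : ℝ} (hε : 0 ≤ ε) (ha : 0 ≤ a) : ‖cut ε a - a‖ ≤ ε := by
  have h := norm_cfcₙ_sub_le ha (continuous_cutFun ε) (cutFun_zero hε) continuous_id rfl
    (C := ε) fun t ht => by
      rw [id, abs_le]
      constructor
      · linarith [le_max_left (t - ε) 0]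
      · linarith [max_le (a := t - ε) (b := 0) (c := t + ε) (by linarith) (by linarith)]
  rwa [cfcₙ_id ℝ a] at h

lemma cut_anti {ε δ : ℝ} (hε : 0 ≤ ε) (hεδ : ε ≤ δ) (a : B) : cut δ a ≤ cut ε a :=
  cfcₙ_mono (fun t _ => max_le_max (by linarith) le_rfl) (continuous_cutFun δ).continuousOn
    (continuous_cutFun ε).continuousOn (cutFun_zero (hε.trans hεδ)) (cutFun_zero hε)

lemma cut_le {ε : ℝ} (hε : 0 ≤ ε) (ha : 0 ≤ a) : cut ε a ≤ a := by
  have h := cut_anti le_rfl hε a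
  rwa [show cut 0 a = a from sub_eq_zero.mp
    (norm_le_zero_iff.mp (norm_cut_sub_le le_rfl ha))] at h

end FunctionalCalculus

/-! ### Closed right ideals and order -/

section RightIdeal

variable {B : Type*} [NonUnitalCStarAlgebra B]

/-- The closed right ideal `closure (b B)`. -/
noncomputable def rightIdeal (b : B) : Submodule ℂ B :=
  (LinearMap.range (LinearMap.mulLeft ℂ b)).topologicalClosure

lemma isClosed_rightIdeal (b : B) : IsClosed (rightIdeal b : Set B) :=
  Submodule.isClosed_topologicalClosure _

lemma mul_mem_rightIdeal_self (b t : B) : b * t ∈ rightIdeal b :=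
  Submodule.le_topologicalClosure _ ⟨t, rfl⟩

lemma rightIdeal_induction {b d : B} (hd : d ∈ rightIdeal b) {p : B → Prop}
    (hp : IsClosed {x | p x}) (h : ∀ t, p (b * t)) : p d := by
  have : (rightIdeal b : Set B) ⊆ {x | p x} :=
    closure_minimal (by rintro _ ⟨t, rfl⟩; exact h t) hp
  exact this hd

lemma mul_mem_rightIdeal {b d : B} (hd : d ∈ rightIdeal b) (t : B) : d * t ∈ rightIdeal b := by
  refine rightIdeal_induction hd (p := fun d => d * t ∈ rightIdeal b)
    ((isClosed_rightIdeal b).preimage (continuous_mul_const t)) fun s => ?_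
  rw [mul_assoc]
  exact mul_mem_rightIdeal_self b _

lemma rightIdeal_le {b b' : B} (hb : b ∈ rightIdeal b') : rightIdeal b ≤ rightIdeal b' :=
  fun _ hd => rightIdeal_induction hd (p := fun d => d ∈ rightIdeal b') (isClosed_rightIdeal b')
    fun t => mul_mem_rightIdeal hb t

lemma mem_rightIdeal_of_norm {b d : B} (h : ∀ ε > 0, ∃ t, ‖d - b * t‖ ≤ ε) :
    d ∈ rightIdeal b := by
  refine (isClosed_rightIdeal b).closure_subset (Metric.mem_closure_iff.mpr fun ε hε => ?_)
  obtain ⟨t, ht⟩ := h (ε / 2) (by positivity)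
  exact ⟨b * t, mul_mem_rightIdeal_self b t, by rw [dist_eq_norm]; linarith⟩

variable [PartialOrder B] [StarOrderedRing B] {a b : B}

/-- The functions `t² / (t + η)²` of a positive element act as an approximate unit on its square
root. Here and below `|t|` stands for `t` to make the functions continuous on the whole line. -/
lemma norm_root_sub_le (hb : 0 ≤ b) {η : ℝ} (hη : 0 < η) :
    ‖root b - cfcₙ (fun t : ℝ => t ^ 2 / (|t| + η) ^ 2) b * root b‖ ≤ √η := by
  have hc : Continuous fun t : ℝ => t ^ 2 / (|t| + η) ^ 2 :=
    Continuous.div (by fun_prop) (by fun_prop) fun t => by positivity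
  rw [root, cfcₙ_mul_cfcₙ hc (by simp) Real.continuous_sqrt Real.sqrt_zero]
  refine norm_cfcₙ_sub_le hb Real.continuous_sqrt Real.sqrt_zero (by fun_prop) (by simp)
    fun t ht => ?_
  have h1 : √t - t ^ 2 / (|t| + η) ^ 2 * √t = √t * (η * (2 * t + η) / (t + η) ^ 2) := by
    rw [abs_of_nonneg ht]
    field_simp
    ring
  rw [h1, abs_of_nonneg (by positivity)]
  refine Real.le_sqrt_of_sq_le ?_
  rw [mul_pow, Real.sq_sqrt ht, div_pow, mul_div_assoc', div_le_iff₀ (by positivity)]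
  nlinarith [mul_nonneg ht (sq_nonneg (t - η)), mul_nonneg ht ht, hη.le, mul_nonneg ht hη.le,
    mul_nonneg (mul_nonneg ht ht) hη.le, mul_nonneg (mul_nonneg ht hη.le) hη.le,
    pow_nonneg ht 3, pow_nonneg ht 4, pow_pos hη 3, mul_nonneg (pow_nonneg ht 3) hη.le,
    pow_pos hη 4, mul_nonneg (mul_nonneg ht ht) (sq_nonneg η), mul_nonneg ht (pow_pos hη 3).le]

/-- The approximate unit of `norm_root_sub_le` lies in the ideal generated by the element. -/
lemma cfcₙ_approx_eq (hb : 0 ≤ b) {η : ℝ} (hη : 0 < η) :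
    cfcₙ (fun t : ℝ => t ^ 2 / (|t| + η) ^ 2) b =
      b * cfcₙ (fun t : ℝ => t / (|t| + η) ^ 2) b := by
  have hc : Continuous fun t : ℝ => t / (|t| + η) ^ 2 :=
    Continuous.div (by fun_prop) (by fun_prop) fun t => by positivity
  have h := cfcₙ_mul_cfcₙ continuous_id' rfl hc (by simp) b
  rw [cfcₙ_id' ℝ b] at h
  rw [h]
  exact cfcₙ_congr_nonneg hb fun t _ => by ring

/-- If `a a^* ≤ s s^*` then `‖(1 - u) a‖ ≤ ‖(1 - u) s‖`, where `1` is a formal unit. -/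
lemma norm_sub_mul_le {a s : B} (h : a * star a ≤ s * star s) (u : B) :
    ‖a - u * a‖ ≤ ‖s - u * s‖ := by
  have key : (a - u * a) * star (a - u * a) ≤ (s - u * s) * star (s - u * s) := by
    obtain ⟨w, hw⟩ := CStarAlgebra.nonneg_iff_eq_star_mul_self.mp (sub_nonneg.mpr h)
    have : (s - u * s) * star (s - u * s) - (a - u * a) * star (a - u * a) =
        (star w - u * star w) * star (star w - u * star w) := by
      have e : ∀ x : B, (x - u * x) * star (x - u * x) =
          x * star x - u * (x * star x) - (x * star x) * star u + u * (x * star x) * star u := by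
        intro x
        simp only [star_sub, star_mul]
        noncomm_ring
      rw [e, e, e, star_star, ← hw]
      noncomm_ring
    rw [← sub_nonneg, this]
    exact mul_star_self_nonneg _
  have h2 := CStarAlgebra.norm_le_norm_of_nonneg_of_le (mul_star_self_nonneg _) key
  rw [CStarRing.norm_self_mul_star, CStarRing.norm_self_mul_star] at h2
  exact abs_le_of_sq_le_sq' (by nlinarith) (norm_nonneg _) |>.2

lemma norm_mul_le_of_mul_star_le {a s : B} (h : a * star a ≤ s * star s) (u : B) :
    ‖u * a‖ ≤ ‖u * s‖ := by
  have key : (u * a) * star (u * a) ≤ (u * s) * star (u * s) := by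
    have := star_right_conjugate_le_conjugate h u
    simpa only [star_mul, mul_assoc] using this
  have h2 := CStarAlgebra.norm_le_norm_of_nonneg_of_le (mul_star_self_nonneg _) key
  rw [CStarRing.norm_self_mul_star, CStarRing.norm_self_mul_star] at h2
  exact abs_le_of_sq_le_sq' (by nlinarith) (norm_nonneg _) |>.2

/-- The approximate unit `u` of `norm_root_sub_le` satisfies `‖(1 - u) √a‖ ≤ ‖(1 - u) √b‖ → 0`. -/
lemma root_mem_rightIdeal_of_le (ha : 0 ≤ a) (hab : a ≤ b) : root a ∈ rightIdeal b := by
  have hb := ha.trans hab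
  refine mem_rightIdeal_of_norm fun ε hε => ?_
  refine ⟨cfcₙ (fun t : ℝ => t / (|t| + ε ^ 2) ^ 2) b * root a, ?_⟩
  rw [← mul_assoc, ← cfcₙ_approx_eq hb (by positivity)]
  refine (norm_sub_mul_le ?_ _).trans
    ((norm_root_sub_le hb (by positivity)).trans (Real.sqrt_sq hε.le).le)
  rwa [star_root, star_root, root_mul_root ha, root_mul_root hb]

lemma root_mem_rightIdeal (hb : 0 ≤ b) : root b ∈ rightIdeal b :=
  root_mem_rightIdeal_of_le hb le_rfl

lemma mem_rightIdeal_of_le (ha : 0 ≤ a) (hab : a ≤ b) : a ∈ rightIdeal b := by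
  rw [← root_mul_root ha]
  exact mul_mem_rightIdeal (root_mem_rightIdeal_of_le ha hab) _

end RightIdeal

/-! ### Cuntz comparison -/

section Comparison

variable {B : Type*} [NonUnitalCStarAlgebra B]

lemma cuntzLE_conj (x b : B) : CuntzLE (x * b * star x) b :=
  ⟨fun _ => x, tendsto_const_nhds⟩

lemma CuntzLE.of_forall_dist {a u : B} (h : ∀ ε > 0, ∃ c, dist c a < ε ∧ CuntzLE c u) :
    CuntzLE a u := by
  rw [cuntzLE_iff]
  intro ε hε
  obtain ⟨c, hc, hcu⟩ := h (ε / 2) (by positivity)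
  obtain ⟨x, hx⟩ := cuntzLE_iff.mp hcu (ε / 2) (by positivity)
  exact ⟨x, (dist_triangle _ c _).trans_lt (by linarith)⟩

lemma isClosed_cuntzLE (u : B) : IsClosed {a | CuntzLE a u} := by
  refine isClosed_of_closure_subset fun a ha => CuntzLE.of_forall_dist fun ε hε => ?_
  obtain ⟨c, hc, hac⟩ := Metric.mem_closure_iff.mp ha ε hε
  exact ⟨c, by rwa [dist_comm], hc⟩

variable [PartialOrder B] [StarOrderedRing B] {a b : B}

lemma sq_cuntzLE (hb : 0 ≤ b) : CuntzLE (b * b) b := by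
  have h := cuntzLE_conj (root b) b
  have e : root b * b * star (root b) = b * b := by
    rw [star_root]
    nth_rw 2 [← root_mul_root hb]
    rw [show root b * (root b * root b) * root b = (root b * root b) * (root b * root b) by
      noncomm_ring, root_mul_root hb]
  rwa [e] at h

/-- For `g(t) = √t / (t + η)` the element `g(b) b² g(b)` is the function `t³ / (t + η)²` of `b`, which
is within `2 η` of `b`. -/
lemma cuntzLE_sq (hb : 0 ≤ b) : CuntzLE b (b * b) := by
  rw [cuntzLE_iff]
  intro ε hε
  have hc : Continuous fun t : ℝ => √t / (|t| + ε / 4) :=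
    Continuous.div (by fun_prop) (by fun_prop) fun t => by positivity
  refine ⟨cfcₙ (fun t : ℝ => √t / (|t| + ε / 4)) b, ?_⟩
  rw [star_cfcₙ_real, dist_eq_norm]
  have e : cfcₙ (fun t : ℝ => √t / (|t| + ε / 4)) b * (b * b) *
      cfcₙ (fun t : ℝ => √t / (|t| + ε / 4)) b =
      cfcₙ (fun t : ℝ => √t / (|t| + ε / 4) * (t * t) * (√t / (|t| + ε / 4))) b := by
    rw [← cfcₙ_mul_cfcₙ (by fun_prop) (by simp) hc (by simp),
      ← cfcₙ_mul_cfcₙ hc (by simp) (by fun_prop) (by simp),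
      ← cfcₙ_mul_cfcₙ continuous_id' rfl continuous_id' rfl, cfcₙ_id' ℝ b]
  have h := norm_cfcₙ_sub_le hb
    (f := fun t : ℝ => √t / (|t| + ε / 4) * (t * t) * (√t / (|t| + ε / 4)))
    (g := fun t => t) (by fun_prop) (by simp) continuous_id' rfl (C := ε / 2) fun t ht => by
      have e : √t / (|t| + ε / 4) * (t * t) * (√t / (|t| + ε / 4)) - t =
          - (t * ((ε / 4) * (2 * t + ε / 4)) / (t + ε / 4) ^ 2) := by
        rw [abs_of_nonneg ht]
        field_simp
        rw [Real.sq_sqrt ht]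
        ring
      rw [e, abs_neg, abs_of_nonneg (by positivity), div_le_iff₀ (by positivity)]
      nlinarith [mul_nonneg ht hε.le, mul_pos hε hε, mul_nonneg ht (sq_nonneg ε),
        mul_nonneg (mul_nonneg ht ht) hε.le, pow_pos hε 3]
  rw [cfcₙ_id' ℝ b] at h
  rw [e]
  linarith

lemma cuntzLE_star_mul_self (x : B) : CuntzLE (star x * x) (x * star x) := by
  refine (cuntzLE_sq (star_mul_self_nonneg x)).trans ?_
  have := cuntzLE_conj (star x) (x * star x)
  rwa [show star x * (x * star x) * star (star x) = star x * x * (star x * x) by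
    rw [star_star]; noncomm_ring] at this

lemma cuntzLE_mul_star_self (x : B) : CuntzLE (x * star x) (star x * x) := by
  simpa using cuntzLE_star_mul_self (star x)

/-- Approximate `a` by `b t`; then `a² = a^* a` is approximated by `t^* b² t ≾ b² ≾ b`. -/
lemma cuntzLE_of_mem_rightIdeal (ha : 0 ≤ a) (hb : 0 ≤ b) (h : a ∈ rightIdeal b) :
    CuntzLE a b := by
  refine (cuntzLE_sq ha).trans ?_
  have h1 : CuntzLE (star a * a) b := by
    refine rightIdeal_induction h (p := fun d => CuntzLE (star d * d) b)
      ((isClosed_cuntzLE b).preimage (continuous_star.mul continuous_id)) fun t => ?_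
    have h2 := (cuntzLE_conj (star t) (b * b)).trans (sq_cuntzLE hb)
    rwa [show star t * (b * b) * star (star t) = star (b * t) * (b * t) by
      rw [star_star, star_mul, (IsSelfAdjoint.of_nonneg hb).star_eq]; noncomm_ring] at h2
  rwa [(IsSelfAdjoint.of_nonneg ha).star_eq] at h1

lemma cuntzLE_of_le (ha : 0 ≤ a) (hab : a ≤ b) : CuntzLE a b :=
  cuntzLE_of_mem_rightIdeal ha (ha.trans hab) (mem_rightIdeal_of_le ha hab)

/-- If `f² = (a - ε)_+` and `‖a - q‖ ≤ ε`, then `(a - ε)_+² = f (a - ε) f ≤ f q f`. -/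
lemma cut_mul_cut_le {q : B} {ε : ℝ} (hε : 0 ≤ ε) (ha : 0 ≤ a) (hq : IsSelfAdjoint q)
    (h : ‖a - q‖ ≤ ε) :
    cut ε a * cut ε a ≤ root (cut ε a) * q * root (cut ε a) := by
  set f : ℝ → ℝ := fun t => √(max (t - ε) 0)
  have hf : Continuous f := by fun_prop
  have hf0 : f 0 = 0 := by simp [f, hε]
  have e : root (cut ε a) = cfcₙ f a := by
    rw [root, cut]
    exact (cfcₙ_comp' Real.sqrt (fun t => max (t - ε) 0) a Real.continuous_sqrt.continuousOn
      Real.sqrt_zero (continuous_cutFun ε).continuousOn (cutFun_zero hε)).symm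
  have e1 : root (cut ε a) * a * root (cut ε a) - ε • (root (cut ε a) * root (cut ε a)) =
      cut ε a * cut ε a := by
    rw [e]
    nth_rw 2 [← cfcₙ_id' ℝ a]
    rw [cut, cfcₙ_mul_cfcₙ hf hf0 continuous_id' rfl, cfcₙ_mul_cfcₙ (by fun_prop) (by simp) hf hf0,
      cfcₙ_mul_cfcₙ hf hf0 hf hf0, ← cfcₙ_smul ε _ a (by fun_prop) (by simp [hf0]),
      ← cfcₙ_sub _ _ a (by fun_prop) (by simp) (by fun_prop) (by simp [hf0]),
      cfcₙ_mul_cfcₙ (continuous_cutFun ε) (cutFun_zero hε) (continuous_cutFun ε) (cutFun_zero hε)]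
    refine cfcₙ_congr_nonneg ha fun t _ => ?_
    have h1 : f t * f t = max (t - ε) 0 := Real.mul_self_sqrt (le_max_right _ _)
    rw [mul_right_comm, smul_eq_mul, h1]
    rcases max_cases (t - ε) 0 with h | h <;> rw [h.1] <;> ring
  have h1 : star (root (cut ε a)) * (a - q) * root (cut ε a) ≤
      ‖a - q‖ • (star (root (cut ε a)) * root (cut ε a)) :=
    CStarAlgebra.star_left_conjugate_le_norm_smul ((IsSelfAdjoint.of_nonneg ha).sub hq)
  have h2 : ‖a - q‖ • (star (root (cut ε a)) * root (cut ε a)) ≤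
      ε • (star (root (cut ε a)) * root (cut ε a)) :=
    smul_le_smul_of_nonneg_right h (star_mul_self_nonneg _)
  have h3 := h1.trans h2
  rw [star_root, mul_sub, sub_mul] at h3
  rw [← e1]
  exact sub_le_comm.mp h3

/-- If `‖a - b‖ ≤ ε`, then `(a - ε)_+ ≾ b`. -/
lemma cut_cuntzLE_of_norm_sub_le {ε : ℝ} (hε : 0 ≤ ε) (ha : 0 ≤ a) (hb : 0 ≤ b)
    (h : ‖a - b‖ ≤ ε) : CuntzLE (cut ε a) b := by
  refine (cuntzLE_sq (cut_nonneg ε a)).trans ((cuntzLE_of_le ?_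
    (cut_mul_cut_le hε ha (IsSelfAdjoint.of_nonneg hb) h)).trans ?_)
  · have := star_mul_self_nonneg (cut ε a)
    rwa [star_cut] at this
  · have := cuntzLE_conj (root (cut ε a)) b
    rwa [star_root] at this

lemma CuntzLE.of_forall_cut (ha : 0 ≤ a) {u : B} (h : ∀ ε > 0, CuntzLE (cut ε a) u) :
    CuntzLE a u :=
  .of_forall_dist fun ε hε => ⟨cut (ε / 2) a, by
    rw [dist_eq_norm]; linarith [norm_cut_sub_le (a := a) (half_pos hε).le ha],
    h _ (by positivity)⟩

/-- If `a ≾ b`, then `a` is approximated by elements `r (b - δ)_+ r^*`, for all small `δ`. -/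
lemma CuntzLE.eventually_cut (h : CuntzLE a b) (hb : 0 ≤ b) {ε : ℝ} (hε : 0 < ε) :
    ∀ᶠ δ in 𝓝[>] (0 : ℝ), ∃ r : B, ‖a - r * cut δ b * star r‖ < ε := by
  obtain ⟨r, hr⟩ := cuntzLE_iff.mp h (ε / 2) (by positivity)
  rw [dist_eq_norm] at hr
  have hpos : 0 < ε / 2 / (‖r‖ * ‖r‖ + 1) := by positivity
  filter_upwards [Ioo_mem_nhdsGT hpos] with δ hδ
  refine ⟨r, ?_⟩
  have h1 : ‖r * (cut δ b - b) * star r‖ ≤ ‖r‖ * δ * ‖r‖ := by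
    refine (norm_mul_le _ _).trans ?_
    rw [norm_star]
    gcongr
    refine (norm_mul_le _ _).trans ?_
    gcongr
    exact norm_cut_sub_le hδ.1.le hb
  have h2 : δ * (‖r‖ * ‖r‖ + 1) < ε / 2 := (lt_div_iff₀ (by positivity)).mp hδ.2
  have h3 : a - r * cut δ b * star r = -(r * b * star r - a) - r * (cut δ b - b) * star r := by
    noncomm_ring
  rw [h3]
  refine (norm_sub_le _ _).trans_lt ?_
  rw [norm_neg]
  nlinarith [hδ.1]

/-- If `a ≾ b`, then every `(a - ε)_+` is below some `(b - δ)_+`. -/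
lemma CuntzLE.exists_cut_le_cut (h : CuntzLE a b) (ha : 0 ≤ a) (hb : 0 ≤ b) {ε : ℝ} (hε : 0 < ε) :
    ∃ δ > 0, CuntzLE (cut ε a) (cut δ b) := by
  obtain ⟨δ, ⟨r, hr⟩, hδ⟩ := ((h.eventually_cut hb hε).and self_mem_nhdsWithin).exists
  exact ⟨δ, hδ, (cut_cuntzLE_of_norm_sub_le hε.le ha
    (star_right_conjugate_nonneg (cut_nonneg δ b) r) hr.le).trans (cuntzLE_conj r _)⟩

end Comparison

/-! ### Exact factorization and unitary dilation -/

section Factorization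

variable {B : Type*} [NonUnitalCStarAlgebra B] [PartialOrder B] [StarOrderedRing B]

lemma norm_mul_eq_norm_root_mul (l z : B) : ‖l * z‖ = ‖root (star l * l) * z‖ := by
  have h : star (l * z) * (l * z) = star (root (star l * l) * z) * (root (star l * l) * z) := by
    rw [star_mul, star_mul, star_root,
      show star z * root (star l * l) * (root (star l * l) * z) =
        star z * (root (star l * l) * root (star l * l)) * z by noncomm_ring,
      root_mul_root (star_mul_self_nonneg l)]
    noncomm_ring
  have h' := congrArg norm h
  rw [CStarRing.norm_star_mul_self, CStarRing.norm_star_mul_self] at h'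
  exact (mul_self_inj (norm_nonneg _) (norm_nonneg _)).mp h'

/-- If `a² ≤ l^* l`, then `a² = x^* x` for some `x` in the closed right ideal of `l`. With the polar
decomposition `l = v |l|` in the bidual, `x` is `v a`, obtained as the limit of
`l g(l^* l) a` for functions `g(t) = √t / (t + η)` which approximate `t ^ (-1 / 2)`. -/
lemma exists_factor {l a : B} (ha : 0 ≤ a) (h : a * a ≤ star l * l) :
    ∃ x ∈ rightIdeal l, star x * x = a * a := by
  set k := star l * l with hk
  have hk0 : 0 ≤ k := star_mul_self_nonneg l
  have ha' : star a = a := (IsSelfAdjoint.of_nonneg ha).star_eq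
  let η : ℕ → ℝ := fun n => 1 / ((n : ℝ) + 1)
  have hη : ∀ n, 0 < η n := fun n => by positivity
  have hη0 : Tendsto (fun n => √(η n)) atTop (𝓝 0) := by
    have := (Real.continuous_sqrt.tendsto 0).comp
      (tendsto_one_div_add_atTop_nhds_zero_nat (𝕜 := ℝ))
    simpa [Function.comp_def, η] using this
  let g : ℕ → ℝ → ℝ := fun n t => √t / (|t| + η n)
  have hg : ∀ n, Continuous (g n) := fun n =>
    Continuous.div (by fun_prop) (by fun_prop) fun t => by have := hη n; positivity
  have hg0 : ∀ n, g n 0 = 0 := fun n => by simp [g]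
  have hsq : a * star a ≤ root k * star (root k) := by
    rwa [ha', star_root, root_mul_root hk0]
  have hroot : ∀ n, ‖root k * cfcₙ (g n) k * root k - root k‖ ≤ √(η n) := fun n => by
    have hgn := hg n
    rw [root, cfcₙ_mul_cfcₙ Real.continuous_sqrt Real.sqrt_zero (hg n) (hg0 n),
      cfcₙ_mul_cfcₙ (by fun_prop) (by simp) Real.continuous_sqrt Real.sqrt_zero]
    refine norm_cfcₙ_sub_le hk0 (by fun_prop) (by simp) Real.continuous_sqrt Real.sqrt_zero
      fun t ht => ?_
    have hpos := hη n
    have e : √t * g n t * √t - √t = -(√t * η n / (t + η n)) := by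
      simp only [g]
      rw [abs_of_nonneg ht]
      field_simp
      rw [Real.sq_sqrt ht]
      ring
    rw [e, abs_neg, abs_of_nonneg (by positivity), div_le_iff₀ (by positivity)]
    obtain ⟨s, hs⟩ : ∃ s, s = √t := ⟨_, rfl⟩
    obtain ⟨e', he'⟩ : ∃ e', e' = √(η n) := ⟨_, rfl⟩
    have h1 : t = s ^ 2 := by rw [hs, Real.sq_sqrt ht]
    have h2 : η n = e' ^ 2 := by rw [he', Real.sq_sqrt hpos.le]
    have hs0 : 0 ≤ s := hs ▸ Real.sqrt_nonneg _
    have he0 : 0 ≤ e' := he' ▸ Real.sqrt_nonneg _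
    rw [← hs, ← he', h1, h2]
    nlinarith [mul_nonneg he0 (sq_nonneg (s - e')), mul_nonneg he0 (mul_nonneg hs0 he0)]
  have hdist : ∀ n m, dist (l * cfcₙ (g n) k * a) (l * cfcₙ (g m) k * a) ≤
      √(η n) + √(η m) := fun n m => by
    rw [dist_eq_norm, show l * cfcₙ (g n) k * a - l * cfcₙ (g m) k * a =
      l * ((cfcₙ (g n) k - cfcₙ (g m) k) * a) by noncomm_ring, norm_mul_eq_norm_root_mul,
      ← mul_assoc]
    refine (norm_mul_le_of_mul_star_le hsq _).trans ?_
    rw [← hk, show root k * (cfcₙ (g n) k - cfcₙ (g m) k) * root k =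
      (root k * cfcₙ (g n) k * root k - root k) -
        (root k * cfcₙ (g m) k * root k - root k) by noncomm_ring]
    exact (norm_sub_le _ _).trans (add_le_add (hroot n) (hroot m))
  have hηanti : ∀ N n, N ≤ n → √(η n) ≤ √(η N) := fun N n h => by
    refine Real.sqrt_le_sqrt (one_div_le_one_div_of_le (by positivity) ?_)
    exact_mod_cast Nat.succ_le_succ h
  have hcauchy : CauchySeq fun n => l * cfcₙ (g n) k * a := by
    refine cauchySeq_of_le_tendsto_0 (fun N => √(η N) + √(η N)) (fun n m N hn hm => ?_) ?_
    · exact (hdist n m).trans (add_le_add (hηanti N n hn) (hηanti N m hm))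
    · simpa using hη0.add hη0
  obtain ⟨x, hx⟩ := cauchySeq_tendsto_of_complete hcauchy
  refine ⟨x, (isClosed_rightIdeal l).mem_of_tendsto hx (Eventually.of_forall fun n => ?_), ?_⟩
  · rw [mul_assoc]
    exact mul_mem_rightIdeal_self l _
  · refine tendsto_nhds_unique (((continuous_star.tendsto x).comp hx).mul hx) ?_
    have e : ∀ n, star (l * cfcₙ (g n) k * a) * (l * cfcₙ (g n) k * a) =
        a * (cfcₙ (fun t : ℝ => t ^ 2 / (|t| + η n) ^ 2) k * a) := fun n => by
      have e2 : cfcₙ (fun t : ℝ => t ^ 2 / (|t| + η n) ^ 2) k =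
          cfcₙ (g n) k * k * cfcₙ (g n) k := by
        have h1 := cfcₙ_mul_cfcₙ (hg n) (hg0 n) continuous_id' rfl k
        rw [cfcₙ_id' ℝ k] at h1
        have hgn := hg n
        rw [h1, cfcₙ_mul_cfcₙ (by fun_prop) (by simp) (hg n) (hg0 n)]
        refine cfcₙ_congr_nonneg hk0 fun t ht => ?_
        simp only [g]
        rw [div_mul_eq_mul_div, div_mul_div_comm, mul_right_comm, Real.mul_self_sqrt ht]
        ring
      rw [star_mul, star_mul, ha', star_cfcₙ_real, e2, hk]
      noncomm_ring
    simp only [Function.comp_def, e]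
    refine (tendsto_iff_norm_sub_tendsto_zero.mpr ?_ : Tendsto _ _ (𝓝 a)).const_mul a
    refine squeeze_zero (fun _ => norm_nonneg _) (fun n => ?_) hη0
    rw [norm_sub_rev]
    exact (norm_sub_mul_le hsq _).trans (norm_root_sub_le hk0 (hη n))

/-- If `‖a - r b r^*‖ ≤ ε`, there is a contraction `c` in the closed right ideal of `b` whose
initial projection dominates the support of `(a - 2ε)_+`. -/
lemma exists_contraction {a b r : B} {ε : ℝ} (hε : 0 < ε) (ha : 0 ≤ a) (hb : 0 ≤ b)
    (h : ‖a - r * b * star r‖ ≤ ε) :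
    ∃ c ∈ rightIdeal b, ‖c‖ ≤ 1 ∧ star c * c * cut (2 * ε) a = cut (2 * ε) a := by
  set f := root (cut ε a)
  have hl : cut ε a * cut ε a ≤ star (root b * star r * f) * (root b * star r * f) := by
    have h1 := cut_mul_cut_le hε.le ha
      (IsSelfAdjoint.of_nonneg (star_right_conjugate_nonneg hb r)) h
    have h2 : star (root b * star r * f) * (root b * star r * f) = f * (r * b * star r) * f := by
      nth_rw 3 [← root_mul_root hb]
      simp only [star_mul, star_star, star_root, f]
      noncomm_ring
    rwa [h2]
  obtain ⟨x, hx, hxx⟩ := exists_factor (cut_nonneg ε a) hl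
  -- As `x^* x = (a - ε)_+²`, the element `c = x g(a)` has `c^* c = ((t - ε)_+ / max (t - ε) ε)⁴ (a)`,
  -- a function which is at most `1`, and equal to `1` for `2 ε ≤ t`.
  let g : ℝ → ℝ := fun t => max (t - ε) 0 / (max (t - ε) ε) ^ 2
  have hpos : ∀ t : ℝ, 0 < max (t - ε) ε := fun t => lt_max_of_lt_right hε
  have hg : Continuous g :=
    Continuous.div (by fun_prop) (by fun_prop) fun t => (pow_pos (hpos t) 2).ne'
  have hg0 : g 0 = 0 := by simp [g, hε.le]
  have hc := continuous_cutFun ε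
  have hc0 := cutFun_zero hε.le
  have e : star (x * cfcₙ g a) * (x * cfcₙ g a) =
      cfcₙ (fun t => g t * (max (t - ε) 0 * max (t - ε) 0) * g t) a := by
    rw [← cfcₙ_mul_cfcₙ (by fun_prop) (by simp [hg0]) hg hg0,
      ← cfcₙ_mul_cfcₙ hg hg0 (by fun_prop) (by simp [hε.le]), ← cfcₙ_mul_cfcₙ hc hc0 hc hc0, star_mul,
      star_cfcₙ_real, show cfcₙ g a * star x * (x * cfcₙ g a) =
        cfcₙ g a * (star x * x) * cfcₙ g a by noncomm_ring, hxx, cut]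
  have hval : ∀ t, g t * (max (t - ε) 0 * max (t - ε) 0) * g t =
      (max (t - ε) 0 / max (t - ε) ε) ^ 4 := fun t => by
    have := hpos t
    simp only [g]
    field_simp
  refine ⟨x * cfcₙ g a, mul_mem_rightIdeal (rightIdeal_le ?_ hx) _, ?_, ?_⟩
  · exact mul_mem_rightIdeal (mul_mem_rightIdeal (root_mem_rightIdeal hb) _) _
  · have h1 : ‖star (x * cfcₙ g a) * (x * cfcₙ g a)‖ ≤ 1 := by
      rw [e]
      refine norm_cfcₙ_le fun t _ => ?_
      rw [hval, Real.norm_of_nonneg (pow_nonneg (div_nonneg (le_max_right _ _) (hpos t).le) 4)]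
      refine pow_le_one₀ (div_nonneg (le_max_right _ _) (hpos t).le) ?_
      exact (div_le_one (hpos t)).mpr (max_le_max le_rfl hε.le)
    rw [CStarRing.norm_star_mul_self] at h1
    nlinarith [norm_nonneg (x * cfcₙ g a)]
  · rw [e, cut, cfcₙ_mul_cfcₙ (by fun_prop) (by simp [hg0]) (continuous_cutFun _)
      (cutFun_zero (by positivity))]
    refine cfcₙ_congr_nonneg ha fun t _ => ?_
    rw [hval]
    rcases le_total t (2 * ε) with ht | ht
    · rw [max_eq_right (by linarith : t - 2 * ε ≤ 0), mul_zero]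
    · rw [max_eq_left (by linarith : 0 ≤ t - ε), max_eq_left (by linarith : ε ≤ t - ε),
        div_self (by linarith : 0 < t - ε).ne']
      simp

end Factorization

section Dilation

variable {M : Type*} [CStarAlgebra M]

/-- A pair of isometries whose ranges are orthogonal and span the whole space, that is, a unital
representation of the Cuntz relations `O₂`. -/
structure CuntzPair (w₀ w₁ : M) : Prop where
  isometry₀ : star w₀ * w₀ = 1
  isometry₁ : star w₁ * w₁ = 1
  orthogonal : star w₀ * w₁ = 0
  sum_eq_one : w₀ * star w₀ + w₁ * star w₁ = 1

variable [PartialOrder M] [StarOrderedRing M]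

/-- For a contraction `c`, the self-adjoint contraction `H = w₁ c w₀^* + w₀ c^* w₁^*` (the matrix
with off-diagonal entries `c` and `c^*`) is the real part of the unitary `H + i √(1 - H²)`, which
acts as `H` on the vectors fixed by `H²`. Followed by the flip of `w₀` and `w₁`, it implements
`y ↦ c y c^*` on all `y` with `c^* c y = y`. -/
lemma CuntzPair.exists_unitary {w₀ w₁ : M} (hw : CuntzPair w₀ w₁) {c : M} (hc : ‖c‖ ≤ 1) :
    ∃ U ∈ unitary M, ∀ y, IsSelfAdjoint y → star c * c * y = y →
      U * (w₀ * y * star w₀) * star U = w₀ * (c * y * star c) * star w₀ := by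
  obtain ⟨h00, h11, h01, hs⟩ := hw
  have h10 : star w₁ * w₀ = 0 := by simpa using congrArg star h01
  have r00 : ∀ z, star w₀ * (w₀ * z) = z := fun z => by rw [← mul_assoc, h00, one_mul]
  have r11 : ∀ z, star w₁ * (w₁ * z) = z := fun z => by rw [← mul_assoc, h11, one_mul]
  have r01 : ∀ z, star w₀ * (w₁ * z) = 0 := fun z => by rw [← mul_assoc, h01, zero_mul]
  have r10 : ∀ z, star w₁ * (w₀ * z) = 0 := fun z => by rw [← mul_assoc, h10, zero_mul]
  set H := w₁ * c * star w₀ + w₀ * star c * star w₁ with hH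
  have hHsa : IsSelfAdjoint H := by
    simp only [IsSelfAdjoint, hH, star_add, star_mul, star_star, mul_assoc]
    exact add_comm _ _
  have hHH : H * H = w₀ * (star c * c) * star w₀ + w₁ * (c * star c) * star w₁ := by
    simp only [hH, mul_add, add_mul, mul_assoc, r00, r11, r01, r10, mul_zero, add_zero, zero_add]
  have hsub : 1 - H ^ 2 = w₀ * (1 - star c * c) * star w₀ + w₁ * (1 - c * star c) * star w₁ := by
    have e : w₀ * (1 - star c * c) * star w₀ + w₁ * (1 - c * star c) * star w₁ =
        (w₀ * star w₀ + w₁ * star w₁) -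
          (w₀ * (star c * c) * star w₀ + w₁ * (c * star c) * star w₁) := by
      noncomm_ring
    rw [e, hs, sq, hHH]
  have hcc : star c * c ≤ 1 := by
    rw [← CStarAlgebra.norm_le_one_iff_of_nonneg _ (star_mul_self_nonneg c),
      CStarRing.norm_star_mul_self]
    exact mul_le_one₀ hc (norm_nonneg _) hc
  have hcc' : c * star c ≤ 1 := by
    rw [← CStarAlgebra.norm_le_one_iff_of_nonneg _ (mul_star_self_nonneg c),
      CStarRing.norm_self_mul_star]
    exact mul_le_one₀ hc (norm_nonneg _) hc
  have hpos : 0 ≤ 1 - H ^ 2 := by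
    rw [hsub]
    exact add_nonneg (star_right_conjugate_nonneg (sub_nonneg.mpr hcc) _)
      (star_right_conjugate_nonneg (sub_nonneg.mpr hcc') _)
  have hHnorm : ‖H‖ ≤ 1 := by
    have h1 : ‖star H * H‖ ≤ 1 := by
      rw [CStarAlgebra.norm_le_one_iff_of_nonneg _ (star_mul_self_nonneg H), hHsa.star_eq, ← sq]
      exact sub_nonneg.mp hpos
    rw [CStarRing.norm_star_mul_self] at h1
    nlinarith [norm_nonneg H]
  have hU := hHsa.self_add_I_smul_cfcSqrt_sub_sq_mem_unitary H hHnorm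
  set s := CFC.sqrt (1 - H ^ 2)
  set U := H + Complex.I • s
  set J := w₀ * star w₁ + w₁ * star w₀ with hJ
  have hJs : star J = J := by
    simp only [hJ, star_add, star_mul, star_star]
    exact add_comm _ _
  have hJJ : J * J = 1 := by
    rw [← hs]
    simp only [hJ, mul_add, add_mul, mul_assoc, r00, r11, r01, r10, mul_zero, add_zero, zero_add]
    exact add_comm _ _
  have hJw : ∀ z, J * (w₁ * z) = w₀ * z := fun z => by
    simp only [hJ, add_mul, mul_assoc, r11, r01, mul_zero, add_zero]
  have hJu : J ∈ unitary M := by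
    rw [Unitary.mem_iff, hJs]
    exact ⟨hJJ, hJJ⟩
  refine ⟨J * U, mul_mem hJu hU, fun y hy hcy => ?_⟩
  have hss : star s = s := (IsSelfAdjoint.of_nonneg (CFC.sqrt_nonneg _)).star_eq
  have hsy : s * (w₀ * y) = 0 := by
    rw [← CStarRing.star_mul_self_eq_zero_iff, star_mul, hss,
      show star (w₀ * y) * s * (s * (w₀ * y)) = star (w₀ * y) * ((s * s) * (w₀ * y)) by
        noncomm_ring, CFC.sqrt_mul_sqrt_self _ hpos, hsub]
    simp only [add_mul, mul_assoc, r00, r10, sub_mul, one_mul, mul_zero]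
    rw [← mul_assoc (star c), hcy, sub_self]
    simp
  have hUy : U * (w₀ * y) = w₁ * (c * y) := by
    rw [add_mul, smul_mul_assoc, hsy, smul_zero, add_zero]
    simp only [hH, add_mul, mul_assoc, r00, r10, mul_zero, add_zero]
  have hyU : y * (star w₀ * star U) = y * star c * star w₁ := by
    have := congrArg star hUy
    simpa only [star_mul, hy.star_eq, mul_assoc] using this
  calc J * U * (w₀ * y * star w₀) * star (J * U)
      = J * (U * (w₀ * (y * (star w₀ * star U)))) * J := by
        rw [star_mul, hJs]
        noncomm_ring
    _ = J * (w₁ * (c * y * star c)) * (star w₁ * J) := by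
        rw [hyU, show U * (w₀ * (y * star c * star w₁)) = U * (w₀ * y) * star c * star w₁ by
          noncomm_ring, hUy]
        noncomm_ring
    _ = w₀ * (c * y * star c) * star w₀ := by
        have h1 : star w₁ * J = star w₀ := by
          simpa [hJs] using congrArg star (hJw 1)
        rw [hJw, h1]

end Dilation

/-! ### Multipliers -/

section Multipliers

variable {B : Type*} [NonUnitalCStarAlgebra B]

/-- The embedding of a C*-algebra in its multiplier algebra. -/
noncomputable abbrev toMult (B : Type*) [NonUnitalCStarAlgebra B] : B →⋆ₙₐ[ℂ] 𝓜(ℂ, B) :=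
  DoubleCentralizer.coeHom

lemma eq_of_forall_mul_eq {a b : B} (h : ∀ x, x * a = x * b) : a = b := by
  rw [← sub_eq_zero, ← CStarRing.star_mul_self_eq_zero_iff, mul_sub, h, sub_self]

lemma eq_of_forall_mul_eq' {a b : B} (h : ∀ x, a * x = b * x) : a = b := by
  rw [← sub_eq_zero, ← CStarRing.mul_star_self_eq_zero_iff, sub_mul, h, sub_self]

lemma toMult_injective : Function.Injective (toMult B) := fun _ _ h =>
  eq_of_forall_mul_eq' fun x => congrArg (fun m : 𝓜(ℂ, B) => m.fst x) h

lemma norm_toMult (b : B) : ‖toMult B b‖ = ‖b‖ :=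
  NonUnitalStarAlgHom.norm_map (toMult B) toMult_injective b

/-- A multiplier is determined by its left action. -/
lemma multiplier_ext {m n : 𝓜(ℂ, B)} (h : ∀ x, m.fst x = n.fst x) : m = n := by
  refine DoubleCentralizer.ext ℂ B m n (Prod.ext (ContinuousLinearMap.ext h)
    (ContinuousLinearMap.ext fun x => ?_))
  exact eq_of_forall_mul_eq' fun y => by
    exact (m.central x y).trans ((congrArg (x * ·) (h y)).trans (n.central x y).symm)

lemma fst_mul (m : 𝓜(ℂ, B)) (a b : B) : m.fst (a * b) = m.fst a * b :=
  eq_of_forall_mul_eq fun x => by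
    rw [← m.central, ← mul_assoc, ← mul_assoc, m.central]

lemma toMult_fst (m : 𝓜(ℂ, B)) (b : B) : toMult B (m.fst b) = m * toMult B b :=
  multiplier_ext fun x => (fst_mul m b x).symm

lemma toMult_snd (m : 𝓜(ℂ, B)) (b : B) : toMult B (m.snd b) = toMult B b * m :=
  multiplier_ext fun x => m.central b x

/-- The element `v b v^*`, for a multiplier `v`. -/
noncomputable def conj (v : 𝓜(ℂ, B)) (b : B) : B := v.fst ((star v).snd b)

lemma toMult_conj (v : 𝓜(ℂ, B)) (b : B) : toMult B (conj v b) = v * toMult B b * star v := by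
  rw [conj, toMult_fst, toMult_snd, mul_assoc]

lemma continuous_conj (v : 𝓜(ℂ, B)) : Continuous (conj v) :=
  (ContinuousLinearMap.continuous _).comp (ContinuousLinearMap.continuous _)

lemma conj_conj (u v : 𝓜(ℂ, B)) (b : B) : conj u (conj v b) = conj (u * v) b :=
  toMult_injective <| by
    rw [toMult_conj, toMult_conj, toMult_conj, star_mul]
    noncomm_ring

lemma conj_mul {v : 𝓜(ℂ, B)} (hv : star v * v = 1) (a b : B) :
    conj v (a * b) = conj v a * conj v b := toMult_injective <| by
  rw [map_mul, toMult_conj, toMult_conj, toMult_conj, map_mul,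
    show v * toMult B a * star v * (v * toMult B b * star v) =
      v * (toMult B a * (star v * v) * toMult B b) * star v by noncomm_ring, hv, mul_one]

lemma conj_star_mul_self (v : 𝓜(ℂ, B)) (y : B) :
    conj v (star y * y) = v.fst (star y) * star (v.fst (star y)) := toMult_injective <| by
  rw [toMult_conj, map_mul, map_mul, map_star, map_star (toMult B) (v.fst (star y)), toMult_fst,
    star_mul, map_star (toMult B) y, star_star]
  noncomm_ring

/-- Conjugation by an isometric multiplier preserves the Cuntz class. -/
lemma conj_equiv {v : 𝓜(ℂ, B)} (hv : star v * v = 1) {b : B} (hb : IsPos b) :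
    CuntzLE (conj v b) b ∧ CuntzLE b (conj v b) := by
  let _ : PartialOrder B := CStarAlgebra.spectralOrder B
  let _ : StarOrderedRing B := CStarAlgebra.spectralOrderedRing B
  obtain ⟨y, rfl⟩ := hb
  have h : star (v.fst (star y)) * v.fst (star y) = y * star y := toMult_injective <| by
    rw [map_mul, map_star, toMult_fst, star_mul, map_mul, map_star, star_star,
      show toMult B y * star v * (v * star (toMult B y)) =
        toMult B y * (star v * v) * star (toMult B y) by noncomm_ring, hv, mul_one]
  rw [conj_star_mul_self]
  refine ⟨(cuntzLE_mul_star_self _).trans ?_, CuntzLE.trans ?_ (cuntzLE_star_mul_self _)⟩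
  · rw [h]
    exact cuntzLE_mul_star_self y
  · rw [h]
    exact cuntzLE_star_mul_self y

lemma conj_nonneg [PartialOrder B] [StarOrderedRing B] (v : 𝓜(ℂ, B)) {b : B} (hb : 0 ≤ b) :
    0 ≤ conj v b := by
  obtain ⟨y, rfl⟩ := isPos_iff.mpr hb
  rw [conj_star_mul_self]
  exact mul_star_self_nonneg _

end Multipliers

/-! ### Row shifts as multipliers of the stabilization -/

namespace FinMat

variable {A : Type*} [NonUnitalCStarAlgebra A]

lemma coeff_mul_of_subset (x y : FinMat A) (i j : ℕ) (s : Finset ℕ)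
    (h : ∀ k ∉ s, x.coeff i k * y.coeff k j = 0) :
    (x * y).coeff i j = ∑ k ∈ s, x.coeff i k * y.coeff k j := by
  obtain ⟨N, hx⟩ := x.exists_supp
  rw [coeff_mul (hx.mono (le_max_left N (s.sup id + 1)))]
  refine (Finset.sum_subset (fun k hk => ?_) fun k _ hk => h k hk).symm
  have : k ≤ s.sup id := Finset.le_sup (f := id) hk
  rw [Finset.mem_range]
  omega

/-- The map `x ↦ v x`, where `v` is the isometry with `v e_n = e_{σ n}`. -/
noncomputable def rowShift (σ : ℕ ↪ ℕ) : FinMat A →ₗ[ℂ] FinMat A where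
  toFun x := mk (fun i j => Function.extend σ (fun k => x.coeff k j) 0 i)
    (max x.size ((Finset.range x.size).sup σ + 1)) (by
      intro i j h
      by_cases hi : ∃ k, σ k = i
      · obtain ⟨k, rfl⟩ := hi
        rw [σ.injective.extend_apply]
        refine x.supp_size k j ?_
        by_contra hk
        have : σ k ≤ (Finset.range x.size).sup σ :=
          Finset.le_sup (f := σ) (Finset.mem_range.mpr (by omega))
        omega
      · exact Function.extend_apply' _ _ _ hi)
  map_add' x y := by
    ext i j
    by_cases hi : ∃ k, σ k = i
    · obtain ⟨k, rfl⟩ := hi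
      simp only [coeff_mk, coeff_add, σ.injective.extend_apply]
    · simp only [coeff_mk, coeff_add, Function.extend_apply' _ _ _ hi, Pi.zero_apply, add_zero]
  map_smul' c x := by
    ext i j
    by_cases hi : ∃ k, σ k = i
    · obtain ⟨k, rfl⟩ := hi
      simp only [coeff_mk, coeff_smul, σ.injective.extend_apply, RingHom.id_apply]
    · simp only [coeff_mk, coeff_smul, Function.extend_apply' _ _ _ hi, Pi.zero_apply, smul_zero,
        RingHom.id_apply]

/-- The map `x ↦ x v`, where `v` is the isometry with `v e_n = e_{σ n}`. -/
noncomputable def colShift (σ : ℕ ↪ ℕ) : FinMat A →ₗ[ℂ] FinMat A where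
  toFun x := ⟨fun i j => x.coeff i (σ j), by
    obtain ⟨M, hM⟩ :=
      (σ.injective.nat_tendsto_atTop.eventually_ge_atTop x.size).exists_forall_of_atTop
    refine ⟨max x.size M, fun i j h => x.supp_size i (σ j) ?_⟩
    rcases h with h | h
    · exact .inl (by omega)
    · exact .inr (hM j (by omega))⟩
  map_add' x y := rfl
  map_smul' c x := rfl

lemma coeff_rowShift (σ : ℕ ↪ ℕ) (x : FinMat A) (i j : ℕ) :
    (rowShift σ x).coeff i j = Function.extend σ (fun k => x.coeff k j) 0 i := rfl

@[simp] lemma coeff_rowShift_apply (σ : ℕ ↪ ℕ) (x : FinMat A) (i j : ℕ) :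
    (rowShift σ x).coeff (σ i) j = x.coeff i j := by
  rw [coeff_rowShift, σ.injective.extend_apply]

lemma coeff_rowShift_of_notMem (σ : ℕ ↪ ℕ) (x : FinMat A) {i : ℕ} (hi : ¬ ∃ k, σ k = i) (j : ℕ) :
    (rowShift σ x).coeff i j = 0 := by
  rw [coeff_rowShift, Function.extend_apply' _ _ _ hi]
  rfl

@[simp] lemma coeff_colShift (σ : ℕ ↪ ℕ) (x : FinMat A) (i j : ℕ) :
    (colShift σ x).coeff i j = x.coeff i (σ j) := rfl

lemma mul_rowShift (σ : ℕ ↪ ℕ) (x y : FinMat A) : x * rowShift σ y = colShift σ x * y := by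
  ext i j
  obtain ⟨N, hy⟩ := y.exists_supp
  rw [coeff_mul_of_subset x _ i j ((Finset.range N).map σ), Finset.sum_map,
    coeff_mul_of_subset (colShift σ x) y i j (Finset.range N)]
  · simp
  · intro k hk
    rw [hy k j (.inl (by simpa using hk)), mul_zero]
  · intro k hk
    by_cases h : ∃ l, σ l = k
    · obtain ⟨l, rfl⟩ := h
      have hl : N ≤ l := by simpa using hk
      rw [coeff_rowShift_apply, hy l j (.inl hl), mul_zero]
    · rw [coeff_rowShift_of_notMem σ y h, mul_zero]

lemma colShift_star_rowShift (σ : ℕ ↪ ℕ) (x : FinMat A) :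
    colShift σ (star (rowShift σ x)) = star x := by
  ext i j
  simp

lemma norm_rowShift (σ : ℕ ↪ ℕ) (x : FinMat A) : ‖rowShift σ x‖ = ‖x‖ := by
  have h : star (rowShift σ x) * rowShift σ x = star x * x := by
    rw [mul_rowShift, colShift_star_rowShift]
  have h' := congrArg norm h
  rw [CStarRing.norm_star_mul_self, CStarRing.norm_star_mul_self] at h'
  exact (mul_self_inj (norm_nonneg _) (norm_nonneg _)).mp h'

/-- Since `(x v) (x v)^* = x (v (x v)^*)` by `mul_rowShift`, and `v` is isometric, one has
`‖x v‖² ≤ ‖x‖ ‖x v‖`. -/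
lemma norm_colShift_le (σ : ℕ ↪ ℕ) (x : FinMat A) : ‖colShift σ x‖ ≤ ‖x‖ := by
  have h : ‖colShift σ x‖ * ‖colShift σ x‖ ≤ ‖x‖ * ‖colShift σ x‖ := by
    rw [← CStarRing.norm_self_mul_star, ← mul_rowShift]
    refine (norm_mul_le _ _).trans ?_
    rw [norm_rowShift, norm_star]
  by_contra! hlt
  exact absurd h (not_le.mpr (mul_lt_mul_of_pos_right hlt ((norm_nonneg x).trans_lt hlt)))

end FinMat

namespace Stab

variable {A : Type*} [NonUnitalCStarAlgebra A]

/-- The inclusion of `M_∞(A)`, as a linear map. -/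
noncomputable def ofL (A : Type*) [NonUnitalCStarAlgebra A] : FinMat A →L[ℂ] Stab A where
  toFun := of
  map_add' := of_add
  map_smul' := of_smul
  cont := continuous_of

lemma isUniformInducing_ofL : IsUniformInducing (ofL A) :=
  (AddMonoidHomClass.isometry_of_norm (ofL A) norm_of).isUniformInducing

lemma denseRange_ofL : DenseRange (ofL A) := isDenseInducing_of.dense

/-- The multiplier of `A ⊗ K` given by the isometry `v` with `v e_n = e_{σ n}`. -/
noncomputable def shift (σ : ℕ ↪ ℕ) : 𝓜(ℂ, Stab A) where
  fst := (ofL A ∘L (FinMat.rowShift σ).mkContinuous 1 fun x => by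
    rw [one_mul, FinMat.norm_rowShift]).extend (ofL A)
  snd := (ofL A ∘L (FinMat.colShift σ).mkContinuous 1 fun x => by
    rw [one_mul]; exact FinMat.norm_colShift_le σ x).extend (ofL A)
  central x y := by
    refine induction₂ x y (isClosed_eq (by fun_prop) (by fun_prop)) fun x y => ?_
    have h1 := ContinuousLinearMap.extend_eq (ofL A ∘L (FinMat.rowShift σ).mkContinuous 1 fun x => by
      rw [one_mul, FinMat.norm_rowShift]) denseRange_ofL isUniformInducing_ofL y
    have h2 := ContinuousLinearMap.extend_eq (ofL A ∘L (FinMat.colShift σ).mkContinuous 1 fun x => by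
      rw [one_mul]; exact FinMat.norm_colShift_le σ x) denseRange_ofL isUniformInducing_ofL x
    exact (congrArg₂ (· * ·) h2 rfl).trans (((of_mul _ _).symm.trans
      (congrArg of (FinMat.mul_rowShift σ x y).symm)).trans ((of_mul _ _).trans
        (congrArg₂ (· * ·) rfl h1.symm)))

lemma shift_fst_of (σ : ℕ ↪ ℕ) (x : FinMat A) :
    (shift σ).fst (of x) = of (FinMat.rowShift σ x) :=
  ContinuousLinearMap.extend_eq (ofL A ∘L (FinMat.rowShift σ).mkContinuous 1 _)
    denseRange_ofL isUniformInducing_ofL x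

lemma shift_snd_of (σ : ℕ ↪ ℕ) (x : FinMat A) :
    (shift σ).snd (of x) = of (FinMat.colShift σ x) :=
  ContinuousLinearMap.extend_eq (ofL A ∘L (FinMat.colShift σ).mkContinuous 1 _)
    denseRange_ofL isUniformInducing_ofL x

lemma star_shift_fst_of (σ : ℕ ↪ ℕ) (x : FinMat A) :
    (star (shift σ) : 𝓜(ℂ, Stab A)).fst (of x) = of (star (FinMat.colShift σ (star x))) := by
  rw [DoubleCentralizer.star_fst, ← of_star, shift_snd_of, ← of_star]

lemma star_shift_snd_of (σ : ℕ ↪ ℕ) (x : FinMat A) :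
    (star (shift σ) : 𝓜(ℂ, Stab A)).snd (of x) = of (star (FinMat.rowShift σ (star x))) := by
  rw [DoubleCentralizer.star_snd, ← of_star, shift_fst_of, ← of_star]

lemma multiplier_ext_of {m n : 𝓜(ℂ, Stab A)} (h : ∀ x, m.fst (of x) = n.fst (of x)) : m = n :=
  multiplier_ext fun x => induction₁ x (isClosed_eq (by fun_prop) (by fun_prop)) h

lemma star_shift_mul_shift (σ : ℕ ↪ ℕ) : star (shift σ) * shift σ = (1 : 𝓜(ℂ, Stab A)) :=
  multiplier_ext_of fun x => by
    rw [DoubleCentralizer.mul_fst, mul_apply_eq_comp, shift_fst_of, star_shift_fst_of,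
      FinMat.colShift_star_rowShift, star_star]
    rfl

lemma star_shift_mul_shift_of_disjoint {σ τ : ℕ ↪ ℕ} (h : ∀ i j, σ i ≠ τ j) :
    star (shift σ) * shift τ = (0 : 𝓜(ℂ, Stab A)) :=
  multiplier_ext_of fun x => by
    rw [DoubleCentralizer.mul_fst, mul_apply_eq_comp, shift_fst_of, star_shift_fst_of]
    refine (congrArg of ?_).trans of_zero
    ext i j
    rw [FinMat.coeff_star, FinMat.coeff_colShift, FinMat.coeff_star, star_star,
      FinMat.coeff_rowShift_of_notMem τ x fun ⟨k, hk⟩ => h i k hk.symm]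
    rfl

/-- The embedding `n ↦ 2 n + r`. -/
def interleave (r : Fin 2) : ℕ ↪ ℕ := ⟨fun n => 2 * n + r, fun a b h => by simpa using h⟩

lemma interleave_apply (r : Fin 2) (n : ℕ) : interleave r n = 2 * n + r := rfl

lemma not_mem_interleave {r : Fin 2} {i : ℕ} (h : i % 2 ≠ r) : ¬ ∃ k, interleave r k = i := by
  rintro ⟨k, rfl⟩
  apply h
  rw [interleave_apply]
  have := r.2
  omega

lemma interleave_div {r : Fin 2} {i : ℕ} (h : i % 2 = r) : interleave r (i / 2) = i := by
  rw [interleave_apply]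
  omega

/-- The two isometries which define the addition of the Cuntz semigroup. -/
lemma cuntzPair_shift :
    CuntzPair (shift (interleave 0) : 𝓜(ℂ, Stab A)) (shift (interleave 1)) where
  isometry₀ := star_shift_mul_shift _
  isometry₁ := star_shift_mul_shift _
  orthogonal := star_shift_mul_shift_of_disjoint fun i j => by
    simp only [interleave_apply, Fin.isValue, Fin.val_zero, Fin.val_one]
    omega
  sum_eq_one := multiplier_ext_of fun x => by
    rw [DoubleCentralizer.add_fst, _root_.add_apply, DoubleCentralizer.mul_fst,
      DoubleCentralizer.mul_fst, mul_apply_eq_comp, mul_apply_eq_comp,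
      star_shift_fst_of, star_shift_fst_of, shift_fst_of, shift_fst_of, ← of_add]
    refine congrArg of ?_
    ext i j
    have key : ∀ r : Fin 2, (FinMat.rowShift (interleave r)
        (star (FinMat.colShift (interleave r) (star x)))).coeff i j =
          if i % 2 = r then x.coeff i j else 0 := fun r => by
      split_ifs with h
      · conv_lhs => rw [← interleave_div h]
        rw [FinMat.coeff_rowShift_apply, FinMat.coeff_star, FinMat.coeff_colShift,
          FinMat.coeff_star, star_star, interleave_div h]
      · exact FinMat.coeff_rowShift_of_notMem _ _ (not_mem_interleave h) _
    rw [FinMat.coeff_add, key, key]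
    rcases Nat.mod_two_eq_zero_or_one i with h | h <;> simp [h]

lemma spread_eq_conj (r : Fin 2) (x : Stab A) :
    spread r x = conj (shift (interleave r)) x := by
  refine induction₁ x (isClosed_eq (continuous_spread r) (continuous_conj _)) fun x => ?_
  rw [spread_of, conj, star_shift_snd_of, shift_fst_of]
  refine congrArg of ?_
  ext i j
  change (FinMat.spreadFun r x).coeff i j = _
  rw [FinMat.coeff_spreadFun]
  by_cases hi : i % 2 = r
  · rw [← interleave_div hi, FinMat.coeff_rowShift_apply, FinMat.coeff_star, interleave_div hi]
    by_cases hj : j % 2 = r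
    · rw [if_pos ⟨hi, hj⟩]
      conv_rhs => rw [← interleave_div hj, FinMat.coeff_rowShift_apply, FinMat.coeff_star,
        star_star]
    · rw [if_neg fun h => hj h.2, FinMat.coeff_rowShift_of_notMem _ _ (not_mem_interleave hj),
        star_zero]
  · rw [if_neg fun h => hi h.1, FinMat.coeff_rowShift_of_notMem _ _ (not_mem_interleave hi)]

lemma spread_equiv (r : Fin 2) {x : Stab A} (hx : IsPos x) :
    CuntzLE (spread r x) x ∧ CuntzLE x (spread r x) :=
  spread_eq_conj r x ▸ conj_equiv (star_shift_mul_shift _) hx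

end Stab

/-! ### Suprema in the Cuntz semigroup -/

section Suprema

variable {D : Type*} [NonUnitalCStarAlgebra D]

lemma conj_mem_rightIdeal {B : Type*} [NonUnitalCStarAlgebra B] {v : 𝓜(ℂ, B)}
    (hv : star v * v = 1) {a b : B} (h : a ∈ rightIdeal b) : conj v a ∈ rightIdeal (conj v b) := by
  refine rightIdeal_induction h (p := fun a => conj v a ∈ rightIdeal (conj v b))
    ((isClosed_rightIdeal _).preimage (continuous_conj v)) fun t => ?_
  rw [conj_mul hv]
  exact mul_mem_rightIdeal_self _ _

/-- If `‖a - r b r^*‖ ≤ ε`, a unitary multiplier moves `(a - 2ε)_+` into the hereditary subalgebra of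
`b`, after both are moved to the range of the first of the two isometries. -/
lemma exists_unitary_mem_rightIdeal [PartialOrder (Stab D)] [StarOrderedRing (Stab D)]
    {a b r : Stab D} {ε : ℝ} (hε : 0 < ε) (ha : 0 ≤ a) (hb : 0 ≤ b)
    (h : ‖a - r * b * star r‖ ≤ ε) :
    ∃ U ∈ unitary 𝓜(ℂ, Stab D),
      conj U (Stab.spread 0 (cut (2 * ε) a)) ∈ rightIdeal (Stab.spread 0 b) := by
  let _ : PartialOrder 𝓜(ℂ, Stab D) := CStarAlgebra.spectralOrder _
  let _ : StarOrderedRing 𝓜(ℂ, Stab D) := CStarAlgebra.spectralOrderedRing _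
  obtain ⟨c, hcb, hc1, hc⟩ := exists_contraction hε ha hb h
  obtain ⟨U, hU, hUy⟩ := (Stab.cuntzPair_shift (A := D)).exists_unitary
    (c := toMult (Stab D) c) (by rwa [norm_toMult])
  refine ⟨U, hU, ?_⟩
  have h1 := hUy (toMult (Stab D) (cut (2 * ε) a))
    (by rw [IsSelfAdjoint, ← map_star, star_cut]) (by rw [← map_star, ← map_mul, ← map_mul, hc])
  have e : conj U (Stab.spread 0 (cut (2 * ε) a)) =
      Stab.spread 0 (c * cut (2 * ε) a * star c) := toMult_injective <| by
    rw [Stab.spread_eq_conj, Stab.spread_eq_conj, toMult_conj, toMult_conj, h1, toMult_conj,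
      map_mul, map_mul, map_star]
  rw [e, Stab.spread_eq_conj, Stab.spread_eq_conj]
  exact conj_mem_rightIdeal (Stab.star_shift_mul_shift _)
    (mul_mem_rightIdeal (mul_mem_rightIdeal hcb _) _)

/-- If `a n ∈ rightIdeal (a (n + 1))` for all `n`, then `w = ∑ 2⁻ⁿ a n / (1 + ‖a n‖)` is a Cuntz
upper bound of the sequence, and every `(w - ε)_+` is below some `a n`. -/
lemma exists_bound_of_mem_rightIdeal {B : Type*} [NonUnitalCStarAlgebra B] [PartialOrder B]
    [StarOrderedRing B] {a : ℕ → B} (ha : ∀ n, 0 ≤ a n)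
    (h : ∀ n, a n ∈ rightIdeal (a (n + 1))) :
    ∃ w : B, 0 ≤ w ∧ (∀ n, CuntzLE (a n) w) ∧ ∀ ε > 0, ∃ n, CuntzLE (cut ε w) (a n) := by
  have hself : ∀ n, a n ∈ rightIdeal (a n) := fun n => mem_rightIdeal_of_le (ha n) le_rfl
  have hmem : ∀ n k, k ≤ n → a k ∈ rightIdeal (a n) := fun n k hkn => by
    induction n, hkn using Nat.le_induction with
    | base => exact hself k
    | succ n _ ih => exact rightIdeal_le (h n) ih
  let s : ℕ → ℝ := fun n => (1 / 2) ^ n / (1 + ‖a n‖)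
  have hs : ∀ n, 0 < s n := fun n => by positivity
  let f : ℕ → B := fun n => s n • a n
  have hf : ∀ n, 0 ≤ f n := fun n => smul_nonneg (hs n).le (ha n)
  have hfn : ∀ n, ‖f n‖ ≤ (1 / 2) ^ n := fun n => by
    rw [norm_smul, Real.norm_of_nonneg (hs n).le, div_mul_eq_mul_div]
    rw [div_le_iff₀ (by positivity)]
    have : (0 : ℝ) < (1 / 2) ^ n := by positivity
    nlinarith [norm_nonneg (a n)]
  have hsum : Summable f := Summable.of_norm_bounded summable_geometric_two hfn
  have hclosed : IsClosed {x : B | 0 ≤ x} := CStarAlgebra.isClosed_nonneg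
  have hpart : ∀ n, 0 ≤ ∑ i ∈ Finset.range n, f i := fun n => Finset.sum_nonneg fun i _ => hf i
  have hlim := hsum.hasSum.tendsto_sum_nat
  have hw : 0 ≤ ∑' n, f n := hclosed.mem_of_tendsto hlim (Eventually.of_forall hpart)
  refine ⟨∑' n, f n, hw, fun n => ?_, fun ε hε => ?_⟩
  · have h1 : f n ≤ ∑' n, f n := by
      rw [← sub_nonneg]
      refine hclosed.mem_of_tendsto (hlim.sub_const (f n)) ?_
      filter_upwards [eventually_gt_atTop n] with m hm
      exact sub_nonneg.mpr (Finset.single_le_sum (f := f) (fun i _ => hf i)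
        (Finset.mem_range.mpr hm))
    refine cuntzLE_of_mem_rightIdeal (ha n) hw ?_
    have h2 := mem_rightIdeal_of_le (hf n) h1
    have h3 : a n = ((s n)⁻¹ : ℂ) • f n := by
      have : ((s n : ℝ) : ℂ) ≠ 0 := by exact_mod_cast (hs n).ne'
      rw [show f n = ((s n : ℝ) : ℂ) • a n from (Complex.coe_smul _ _).symm, smul_smul,
        inv_mul_cancel₀ this, one_smul]
    rw [h3]
    exact Submodule.smul_mem _ _ h2
  · obtain ⟨n, hn⟩ := ((Metric.tendsto_nhds.mp hlim) ε hε).exists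
    refine ⟨n, (cut_cuntzLE_of_norm_sub_le hε.le hw (hpart n) ?_).trans
      (cuntzLE_of_mem_rightIdeal (hpart n) (ha n) ?_)⟩
    · rw [← dist_eq_norm, dist_comm]
      exact hn.le
    · refine Submodule.sum_mem _ fun i hi => ?_
      rw [show f i = ((s i : ℝ) : ℂ) • a i from (Complex.coe_smul _ _).symm]
      exact Submodule.smul_mem _ _ (hmem n i (Finset.mem_range.mp hi).le)

/-- Suppose that unitaries `U n` move `y n` into the hereditary subalgebra of `y (n + 1)`.
Conjugating back by `U (n - 1) ⋯ U 0` turns the `y n` into generators of increasing hereditary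
subalgebras. -/
lemma exists_bound_of_unitary {B : Type*} [NonUnitalCStarAlgebra B] [PartialOrder B]
    [StarOrderedRing B] {y : ℕ → B} (hy : ∀ n, 0 ≤ y n) {U : ℕ → 𝓜(ℂ, B)}
    (hU : ∀ n, U n ∈ unitary 𝓜(ℂ, B)) (h : ∀ n, conj (U n) (y n) ∈ rightIdeal (y (n + 1))) :
    ∃ w : B, 0 ≤ w ∧ (∀ n, CuntzLE (y n) w) ∧ ∀ ε > 0, ∃ n, CuntzLE (cut ε w) (y n) := by
  obtain ⟨W, hW0, hW1⟩ : ∃ W : ℕ → 𝓜(ℂ, B), W 0 = 1 ∧ ∀ n, W (n + 1) = W n * star (U n) :=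
    ⟨fun n => Nat.rec 1 (fun n w => w * star (U n)) n, rfl, fun _ => rfl⟩
  have hW : ∀ n, W n ∈ unitary 𝓜(ℂ, B) := fun n => by
    induction n with
    | zero =>
      rw [hW0]
      exact one_mem _
    | succ n ih =>
      rw [hW1]
      exact mul_mem ih (Unitary.star_mem (hU n))
  have hWs : ∀ n, star (W n) * W n = 1 := fun n => (Unitary.mem_iff.mp (hW n)).1
  have hUs : ∀ n, star (U n) * U n = 1 := fun n => (Unitary.mem_iff.mp (hU n)).1
  have hay : ∀ n, CuntzLE (conj (W n) (y n)) (y n) ∧ CuntzLE (y n) (conj (W n) (y n)) := fun n =>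
    conj_equiv (hWs n) (isPos_iff.mpr (hy n))
  obtain ⟨w, hw0, hw1, hw2⟩ := exists_bound_of_mem_rightIdeal (a := fun n => conj (W n) (y n))
    (fun n => conj_nonneg _ (hy n)) fun n => by
      have h1 := conj_mem_rightIdeal (hWs (n + 1)) (h n)
      rwa [conj_conj, show W (n + 1) * U n = W n from by
        rw [hW1, mul_assoc, hUs n, mul_one]] at h1
  refine ⟨w, hw0, fun n => (hay n).2.trans (hw1 n), fun ε hε => ?_⟩
  obtain ⟨n, hn⟩ := hw2 ε hε
  exact ⟨n, hn.trans (hay n).1⟩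

/-- A Cuntz increasing sequence `z` in `(D ⊗ K)_+` has an upper bound `w` such that every
`(w - ε)_+` is below some `z n`. For this, the `z n` are cut down to elements `y n = (z n - δ n)_+`
to which `exists_bound_of_unitary` applies. -/
lemma exists_bound [PartialOrder (Stab D)] [StarOrderedRing (Stab D)] {z : ℕ → Stab D}
    (hz : ∀ n, 0 ≤ z n) (hmono : ∀ n m, n ≤ m → CuntzLE (z n) (z m)) :
    ∃ w : Stab D, 0 ≤ w ∧ (∀ n, CuntzLE (z n) w) ∧ ∀ ε > 0, ∃ n, CuntzLE (cut ε w) (z n) := by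
  -- Given the bound `d = δ n`, the next one `δ` is so small that `(z (n + 1) - δ)_+` still dominates
  -- `z n` up to `d / 2`, and `z 0, …, z n` up to `1 / (n + 1)`.
  have hstep : ∀ (n : ℕ) (d : ℝ), 0 < d → ∃ δ > 0,
      (∃ r, ‖z n - r * cut δ (z (n + 1)) * star r‖ < d / 2) ∧
      ∀ j ≤ n, ∃ r, ‖z j - r * cut δ (z (n + 1)) * star r‖ < 1 / ((n : ℝ) + 1) := by
    intro n d hd
    have h1 := (hmono n (n + 1) n.le_succ).eventually_cut (hz _) (half_pos hd)
    have h2 : ∀ᶠ δ in 𝓝[>] (0 : ℝ), ∀ j ∈ Set.Iic n,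
        ∃ r, ‖z j - r * cut δ (z (n + 1)) * star r‖ < 1 / ((n : ℝ) + 1) :=
      (eventually_all_finite (Set.finite_Iic n)).mpr fun j hj =>
        (hmono j (n + 1) (hj.trans n.le_succ)).eventually_cut (hz _) (by positivity)
    obtain ⟨δ, ⟨h1, h2⟩, hδ⟩ := ((h1.and h2).and self_mem_nhdsWithin).exists
    exact ⟨δ, hδ, h1, h2⟩
  choose step hstep0 hstep1 hstep2 using hstep
  let δ' : ℕ → {d : ℝ // 0 < d} := fun n =>
    Nat.rec ⟨1, one_pos⟩ (fun n d => ⟨step n d.1 d.2, hstep0 n d.1 d.2⟩) n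
  let δ : ℕ → ℝ := fun n => (δ' n).1
  have hδ : ∀ n, 0 < δ n := fun n => (δ' n).2
  let y : ℕ → Stab D := fun n => cut (δ n) (z n)
  have hy : ∀ n, 0 ≤ y n := fun n => cut_nonneg _ _
  have hy1 : ∀ n, ∃ r, ‖z n - r * y (n + 1) * star r‖ < δ n / 2 := fun n =>
    hstep1 n (δ n) (hδ n)
  have hy2 : ∀ n, ∀ j ≤ n, ∃ r, ‖z j - r * y (n + 1) * star r‖ < 1 / ((n : ℝ) + 1) :=
    fun n => hstep2 n (δ n) (hδ n)
  have hU : ∀ n, ∃ U ∈ unitary 𝓜(ℂ, Stab D),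
      conj U (Stab.spread 0 (y n)) ∈ rightIdeal (Stab.spread 0 (y (n + 1))) := by
    intro n
    obtain ⟨r, hr⟩ := hy1 n
    have := exists_unitary_mem_rightIdeal (half_pos (hδ n)) (hz n) (hy (n + 1)) hr.le
    rwa [mul_div_cancel₀ (δ n) two_ne_zero] at this
  choose U hU hUy using hU
  have hspread : ∀ n, 0 ≤ Stab.spread 0 (y n) := fun n =>
    Stab.spread_eq_conj 0 (y n) ▸ conj_nonneg _ (hy n)
  obtain ⟨w, hw0, hw1, hw2⟩ := exists_bound_of_unitary hspread hU hUy
  have hs : ∀ n, CuntzLE (Stab.spread 0 (y n)) (y n) ∧ CuntzLE (y n) (Stab.spread 0 (y n)) :=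
    fun n => Stab.spread_equiv 0 (isPos_iff.mpr (hy n))
  refine ⟨w, hw0, fun j => CuntzLE.of_forall_dist fun ε hε => ?_, fun ε hε => ?_⟩
  · obtain ⟨n, hn⟩ := ((tendsto_one_div_add_atTop_nhds_zero_nat (𝕜 := ℝ)).eventually_lt_const
      hε |>.and (eventually_ge_atTop j)).exists
    obtain ⟨r, hr⟩ := hy2 n j hn.2
    refine ⟨r * y (n + 1) * star r, ?_, (cuntzLE_conj r _).trans ((hs (n + 1)).2.trans (hw1 (n + 1)))⟩
    rw [dist_comm, dist_eq_norm]
    exact hr.trans hn.1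
  · obtain ⟨n, hn⟩ := hw2 ε hε
    exact ⟨n, hn.trans ((hs n).1.trans (cuntzLE_of_le (hy n) (cut_le (hδ n).le (hz n))))⟩

end Suprema

/-! ### Compact containment -/

section CompactContainment

variable {D : Type*} [NonUnitalCStarAlgebra D]

lemma IsPos.cut {B : Type*} [NonUnitalCStarAlgebra B] (ε : ℝ) (a : B) : IsPos (cut ε a) := by
  let _ : PartialOrder B := CStarAlgebra.spectralOrder B
  let _ : StarOrderedRing B := CStarAlgebra.spectralOrderedRing B
  exact isPos_iff.mpr (cut_nonneg ε a)

lemma IsPos.star_mul_self {B : Type*} [NonUnitalCStarAlgebra B] (x : B) : IsPos (star x * x) :=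
  ⟨x, rfl⟩

lemma Cu.mk_le_mk {a b : Stab D} {ha : IsPos a} {hb : IsPos b} :
    Cu.mk a ha ≤ Cu.mk b hb ↔ CuntzLE a b := Iff.rfl

lemma Cu.mk_eq_mk {a b : Stab D} {ha : IsPos a} {hb : IsPos b} :
    Cu.mk a ha = Cu.mk b hb ↔ CuntzLE a b ∧ CuntzLE b a :=
  le_antisymm_iff

lemma Cu.mk_add_mk {a b : Stab D} {ha : IsPos a} {hb : IsPos b} :
    Cu.mk a ha + Cu.mk b hb = Cu.mk (Stab.dsum a b) (ha.dsum hb) := rfl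

lemma Cu.exists_mk (s : Cu D) : ∃ a ha, Cu.mk a ha = s := by
  obtain ⟨⟨a, ha⟩, rfl⟩ := Quotient.exists_rep s
  exact ⟨a, ha, rfl⟩

lemma CompactlyContained.mono {S : Type*} [PartialOrder S] {s s' t t' : S} (hs : s ≤ s')
    (h : CompactlyContained s' t) (ht : t ≤ t') : CompactlyContained s t' := fun z hz w hw hle => by
  obtain ⟨m, hm⟩ := h z hz w hw (ht.trans hle)
  exact ⟨m, hs.trans hm⟩

/-- `[(a - ε)_+] ≪ [a]`. Given an increasing sequence with supremum above `[a]`, its upper bound `w`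
from `exists_bound` satisfies `(a - ε)_+ ≾ (w - δ)_+`, and the latter is below a term. -/
lemma compactlyContained_cut {a : Stab D} (ha : IsPos a) {ε : ℝ} (hε : 0 < ε) :
    CompactlyContained (Cu.mk (cut ε a) (.cut ε a)) (Cu.mk a ha) := by
  intro z hz v hv hle
  let _ : PartialOrder (Stab D) := CStarAlgebra.spectralOrder _
  let _ : StarOrderedRing (Stab D) := CStarAlgebra.spectralOrderedRing _
  choose b hb hbz using fun n => Cu.exists_mk (z n)
  obtain ⟨w, hw0, hw1, hw2⟩ := exists_bound (fun n => isPos_iff.mp (hb n)) fun n m hnm => by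
    have := hz hnm
    rwa [← hbz n, ← hbz m] at this
  have hvw : v ≤ Cu.mk w (isPos_iff.mpr hw0) := hv.2 <| by
    rintro _ ⟨n, rfl⟩
    rw [← hbz n]
    exact hw1 n
  obtain ⟨δ, hδ, hcut⟩ :=
    CuntzLE.exists_cut_le_cut (Cu.mk_le_mk.mp (hle.trans hvw)) (isPos_iff.mp ha) hw0 hε
  obtain ⟨n, hn⟩ := hw2 δ hδ
  exact ⟨n, by rw [← hbz n]; exact hcut.trans hn⟩

/-- This holds because `[a]` is the supremum of the increasing sequence `[(a - 1 / n)_+]`. -/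
lemma exists_le_cut_of_compactlyContained {s : Cu D} {a : Stab D} (ha : IsPos a)
    (h : CompactlyContained s (Cu.mk a ha)) :
    ∃ ε > 0, s ≤ Cu.mk (cut ε a) (.cut ε a) := by
  let _ : PartialOrder (Stab D) := CStarAlgebra.spectralOrder _
  let _ : StarOrderedRing (Stab D) := CStarAlgebra.spectralOrderedRing _
  have ha' := isPos_iff.mp ha
  have hlub : IsLUB (Set.range fun n : ℕ => Cu.mk (cut (1 / ((n : ℝ) + 1)) a) (.cut _ a))
      (Cu.mk a ha) := by
    refine ⟨?_, fun u hu => ?_⟩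
    · rintro _ ⟨n, rfl⟩
      exact cuntzLE_of_le (cut_nonneg _ _) (cut_le (by positivity) ha')
    · obtain ⟨b, hb, rfl⟩ := Cu.exists_mk u
      refine CuntzLE.of_forall_cut ha' fun ε hε => ?_
      obtain ⟨n, hn⟩ := exists_nat_one_div_lt hε
      exact (cuntzLE_of_le (cut_nonneg _ _) (cut_anti (by positivity) hn.le a)).trans
        (Cu.mk_le_mk.mp (hu ⟨n, rfl⟩))
  obtain ⟨m, hm⟩ := h _ (fun n m hnm => cuntzLE_of_le (cut_nonneg _ _) (cut_anti (by positivity)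
    (one_div_le_one_div_of_le (by positivity) (by gcongr)) a)) _ hlub le_rfl
  exact ⟨1 / ((m : ℝ) + 1), by positivity, hm⟩

/-- A monotone map which is determined by its values on compactly contained elements preserves
suprema of increasing sequences. -/
lemma isLUB_of_compactlyContained {S T : Type*} [PartialOrder S] [PartialOrder T] {f : S → T}
    (hf : Monotone f)
    (h : ∀ s u, (∀ s', CompactlyContained s' s → f s' ≤ u) → f s ≤ u) (z : ℕ → S) (w : S)
    (hz : Monotone z) (hw : IsLUB (Set.range z) w) : IsLUB (Set.range fun n => f (z n)) (f w) := by
  refine ⟨?_, fun u hu => h w u fun s' hs' => ?_⟩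
  · rintro _ ⟨n, rfl⟩
    exact hf (hw.1 ⟨n, rfl⟩)
  · obtain ⟨m, hm⟩ := hs' z hz w hw le_rfl
    exact (hf hm).trans (hu ⟨m, rfl⟩)

/-- The sum of two orthogonal positive elements is their sum in the Cuntz semigroup. -/
lemma dsum_equiv_add {x₁ x₂ : Stab D} (h : x₁ * star x₂ = 0) :
    CuntzLE (star x₁ * x₁ + star x₂ * x₂) (Stab.dsum (x₁ * star x₁) (x₂ * star x₂)) ∧
      CuntzLE (Stab.dsum (x₁ * star x₁) (x₂ * star x₂)) (star x₁ * x₁ + star x₂ * x₂) := by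
  let _ : PartialOrder (Stab D) := CStarAlgebra.spectralOrder _
  let _ : StarOrderedRing (Stab D) := CStarAlgebra.spectralOrderedRing _
  obtain ⟨h00, h11, h01, -⟩ := Stab.cuntzPair_shift (A := D)
  set w₀ : 𝓜(ℂ, Stab D) := Stab.shift (Stab.interleave 0)
  set w₁ : 𝓜(ℂ, Stab D) := Stab.shift (Stab.interleave 1)
  have h10 : star w₁ * w₀ = 0 := by simpa using congrArg star h01
  have h' : x₂ * star x₁ = 0 := by simpa using congrArg star h
  let x := w₀.fst x₁ + w₁.fst x₂
  have e1 : star x * x = star x₁ * x₁ + star x₂ * x₂ := toMult_injective <| by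
    simp only [x, map_mul, map_star, map_add, toMult_fst, star_add, star_mul]
    have : ∀ a b c d : 𝓜(ℂ, Stab D), (star a * star w₀ + star b * star w₁) * (w₀ * c + w₁ * d) =
        star a * (star w₀ * w₀) * c + star a * (star w₀ * w₁) * d +
          star b * (star w₁ * w₀) * c + star b * (star w₁ * w₁) * d := by
      intros
      noncomm_ring
    rw [this, h00, h01, h10, h11]
    simp
  have e2 : x * star x = Stab.dsum (x₁ * star x₁) (x₂ * star x₂) := toMult_injective <| by
    have h2 : toMult (Stab D) x₁ * star (toMult (Stab D) x₂) = 0 := by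
      rw [← map_star, ← map_mul, h, map_zero]
    have h3 : toMult (Stab D) x₂ * star (toMult (Stab D) x₁) = 0 := by
      rw [← map_star, ← map_mul, h', map_zero]
    simp only [x, Stab.dsum, Stab.spread_eq_conj, toMult_conj, map_mul, map_star, map_add,
      toMult_fst, star_add, star_mul]
    have : ∀ a b : 𝓜(ℂ, Stab D), (w₀ * a + w₁ * b) * (star a * star w₀ + star b * star w₁) =
        w₀ * (a * star a) * star w₀ + w₀ * (a * star b) * star w₁ +
          w₁ * (b * star a) * star w₀ + w₁ * (b * star b) * star w₁ := by
      intros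
      noncomm_ring
    rw [this, h2, h3]
    simp [w₀, w₁]
  rw [← e1, ← e2]
  exact ⟨cuntzLE_star_mul_self x, cuntzLE_mul_star_self x⟩

end CompactContainment

/-! ### The product of `C ⊗ K` and a `C`-algebra -/

section CentralMultipliers

variable {A : Type*} [NonUnitalCStarAlgebra A] {C : Type*} [CStarAlgebra C]
  {θ : C →⋆ₐ[ℂ] 𝓜(ℂ, A)}

lemma toMult_mulAct (m : 𝓜(ℂ, A)) (a : A) : toMult A (mulAct m a) = m * toMult A a :=
  toMult_fst m a

lemma mulAct_mul_mulAct (hθ : ∀ f, θ f ∈ Set.center 𝓜(ℂ, A)) (f g : C) (a b : A) :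
    mulAct (θ f) a * mulAct (θ g) b = mulAct (θ (f * g)) (a * b) := toMult_injective <| by
  simp only [toMult_mulAct, map_mul]
  rw [show θ f * toMult A a * (θ g * toMult A b) = θ f * (toMult A a * θ g) * toMult A b by
    noncomm_ring, ((hθ g).comm (toMult A a)).symm.eq]
  noncomm_ring

lemma star_mulAct (hθ : ∀ f, θ f ∈ Set.center 𝓜(ℂ, A)) (f : C) (a : A) :
    star (mulAct (θ f) a) = mulAct (θ (star f)) (star a) := toMult_injective <| by
  rw [map_star, toMult_mulAct, toMult_mulAct, star_mul, map_star, map_star, ← map_star θ,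
    ((hθ (star f)).comm _).eq]

lemma exists_norm_sq_smul_one_sub_eq {M : Type*} [CStarAlgebra M] (x : M) :
    ∃ g : M, ((‖x‖ ^ 2 : ℝ) : ℂ) • (1 : M) - star x * x = star g * g := by
  let _ : PartialOrder M := CStarAlgebra.spectralOrder M
  let _ : StarOrderedRing M := CStarAlgebra.spectralOrderedRing M
  have h := CStarAlgebra.star_mul_le_algebraMap_norm_sq (a := x)
  rw [Algebra.algebraMap_eq_smul_one, ← Complex.coe_smul] at h
  exact CStarAlgebra.nonneg_iff_eq_star_mul_self.mp (sub_nonneg.mpr h)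

end CentralMultipliers

namespace FinMat

variable {A : Type*} [NonUnitalCStarAlgebra A] {C : Type*} [CStarAlgebra C]

/-- The matrix `F · a = (θ(F_{ij}) a)`. -/
noncomputable def act (θ : C →⋆ₐ[ℂ] 𝓜(ℂ, A)) : FinMat C →ₗ[ℂ] A →ₗ[ℂ] FinMat A :=
  LinearMap.mk₂ ℂ
    (fun F a => mk (fun i j => mulAct (θ (F.coeff i j)) a) F.size fun i j h => by
      rw [F.supp_size i j h, map_zero]
      rfl)
    (fun F G a => by ext i j; simp [mulAct])
    (fun c F a => by ext i j; simp [mulAct])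
    (fun F a b => by ext i j; simp [mulAct])
    (fun c F a => by ext i j; simp [mulAct])

variable {θ : C →⋆ₐ[ℂ] 𝓜(ℂ, A)}

@[simp] lemma coeff_act (F : FinMat C) (a : A) (i j : ℕ) :
    (act θ F a).coeff i j = mulAct (θ (F.coeff i j)) a := rfl

lemma Supp.act {F : FinMat C} {N : ℕ} (hF : F.Supp N) (a : A) : (FinMat.act θ F a).Supp N :=
  fun i j h => by
    rw [coeff_act, hF i j h, map_zero]
    rfl

lemma act_mul_act (hθ : ∀ f, θ f ∈ Set.center 𝓜(ℂ, A)) (F G : FinMat C) (a b : A) :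
    act θ F a * act θ G b = act θ (F * G) (a * b) := by
  obtain ⟨N, hF⟩ := F.exists_supp
  ext i j
  rw [coeff_mul (hF.act a), coeff_act, coeff_mul hF, map_sum]
  simp only [coeff_act, mulAct_mul_mulAct hθ]
  refine toMult_injective ?_
  rw [map_sum, toMult_mulAct, Finset.sum_mul]
  exact Finset.sum_congr rfl fun k _ => toMult_mulAct _ _

lemma star_act (hθ : ∀ f, θ f ∈ Set.center 𝓜(ℂ, A)) (F : FinMat C) (a : A) :
    star (act θ F a) = act θ (star F) (star a) := by
  ext i j
  rw [coeff_star, coeff_act, star_mulAct hθ, coeff_act, coeff_star]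

/-- The unit matrix of `M_N(C)`. -/
noncomputable def idMat (C : Type*) [CStarAlgebra C] (N : ℕ) : FinMat C :=
  mk (fun i j => if i = j ∧ i < N then 1 else 0) N fun i j h => if_neg (by omega)

lemma idMat_supp (N : ℕ) : (idMat C N).Supp N := fun i j h => if_neg (by omega)

lemma coeff_idMat (N i j : ℕ) : (idMat C N).coeff i j = if i = j ∧ i < N then 1 else 0 := rfl

lemma idMat_mul_idMat (N : ℕ) : idMat C N * idMat C N = idMat C N := by
  ext i j
  rw [coeff_mul (idMat_supp N)]
  simp only [coeff_idMat]
  by_cases h : i < N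
  · rw [Finset.sum_eq_single i]
    · simp [h]
    · intro k _ hk
      rw [if_neg fun h => hk h.1.symm, zero_mul]
    · intro hi
      exact absurd (Finset.mem_range.mpr h) hi
  · rw [if_neg fun h' => h h'.2]
    exact Finset.sum_eq_zero fun k _ => by rw [if_neg fun h' => h h'.2, zero_mul]

lemma star_idMat (N : ℕ) : star (idMat C N) = idMat C N := by
  ext i j
  rw [coeff_star, coeff_idMat, coeff_idMat]
  by_cases h : i = j
  · subst h
    split_ifs <;> simp
  · rw [if_neg fun h' => h h'.1.symm, if_neg fun h' => h h'.1, star_zero]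

lemma corner_idMat (N : ℕ) : corner N (idMat C N) = 1 := by
  ext i j
  rw [corner_apply, coeff_idMat, CStarMatrix.one_apply]
  simp [Fin.ext_iff]

/-- In the unital C*-algebra `M_N(C)` the element `‖F‖² - F^* F` is positive. -/
lemma exists_norm_sq_sub_eq {F : FinMat C} {N : ℕ} (hF : F.Supp N) :
    ∃ G : FinMat C, ((‖F‖ ^ 2 : ℝ) : ℂ) • idMat C N - star F * F = star G * G := by
  let _ : PartialOrder C := CStarAlgebra.spectralOrder C
  let _ : StarOrderedRing C := CStarAlgebra.spectralOrderedRing C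
  obtain ⟨g, hg⟩ := exists_norm_sq_smul_one_sub_eq (corner N F)
  refine ⟨pad g, corner_injOn (N := N) ?_ ((pad_supp g).star.mul (pad_supp g)) ?_⟩
  · intro i j hij
    rw [coeff_sub, (idMat_supp N).smul _ i j hij, (hF.star.mul hF) i j hij, sub_zero]
  · have e : corner N (((‖F‖ ^ 2 : ℝ) : ℂ) • idMat C N - star F * F) =
        ((‖F‖ ^ 2 : ℝ) : ℂ) • corner N (idMat C N) - corner N (star F * F) := rfl
    rw [e, corner_idMat, corner_mul hF.star, corner_mul (pad_supp g).star, corner_star, corner_star,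
      corner_pad, ← hg, norm_eq hF]
    rfl

end FinMat

namespace Stab

variable {A : Type*} [NonUnitalCStarAlgebra A] {C : Type*} [CStarAlgebra C]
  {θ : C →⋆ₐ[ℂ] 𝓜(ℂ, A)}

/-- With `G^* G = ‖F‖² 1_N - F^* F`, the element `‖F‖² (1_N ⊗ a^* a) - (F · a)^* (F · a)` is
`(G · a)^* (G · a)`, hence positive. -/
lemma norm_of_act_le (hθ : ∀ f, θ f ∈ Set.center 𝓜(ℂ, A)) (F : FinMat C) (a : A) :
    ‖FinMat.act θ F a‖ ≤ ‖F‖ * ‖a‖ := by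
  let _ : PartialOrder (Stab A) := CStarAlgebra.spectralOrder _
  let _ : StarOrderedRing (Stab A) := CStarAlgebra.spectralOrderedRing _
  obtain ⟨N, hF⟩ := F.exists_supp
  obtain ⟨G, hG⟩ := FinMat.exists_norm_sq_sub_eq hF
  -- `a ↦ 1_N ⊗ a` is a *-homomorphism, hence contractive
  let φ : A →⋆ₙₐ[ℂ] Stab A :=
    { toFun := fun a => of (FinMat.act θ (FinMat.idMat C N) a)
      map_smul' := fun c a => by rw [map_smul, of_smul]; rfl
      map_zero' := by rw [map_zero, of_zero]
      map_add' := fun a b => by rw [map_add, of_add]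
      map_mul' := fun a b => by
        rw [← of_mul, FinMat.act_mul_act hθ, FinMat.idMat_mul_idMat]
      map_star' := fun a => by rw [← of_star, FinMat.star_act hθ, FinMat.star_idMat] }
  have hφ := NonUnitalStarAlgHom.norm_apply_le φ a
  set P := of (FinMat.act θ F a) with hP
  have key : ((‖F‖ ^ 2 : ℝ) : ℂ) • (star (φ a) * φ a) - star P * P =
      star (of (FinMat.act θ G a)) * of (FinMat.act θ G a) := by
    change ((‖F‖ ^ 2 : ℝ) : ℂ) • (star (of (FinMat.act θ (FinMat.idMat C N) a)) *
      of (FinMat.act θ (FinMat.idMat C N) a)) - _ = _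
    rw [hP]
    simp only [← of_star, ← of_mul, ← of_smul, FinMat.star_act hθ, FinMat.act_mul_act hθ, ← hG,
      FinMat.star_idMat, FinMat.idMat_mul_idMat]
    rw [map_sub, map_smul]
    exact ((ofL A).map_sub _ _).symm
  have hle : star P * P ≤ ((‖F‖ ^ 2 : ℝ) : ℂ) • (star (φ a) * φ a) := by
    rw [← sub_nonneg, key]
    exact star_mul_self_nonneg _
  have h2 := CStarAlgebra.norm_le_norm_of_nonneg_of_le (star_mul_self_nonneg P) hle
  rw [norm_smul, CStarRing.norm_star_mul_self, CStarRing.norm_star_mul_self, Complex.norm_real,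
    Real.norm_of_nonneg (by positivity)] at h2
  have h3 : ‖P‖ ≤ ‖F‖ * ‖φ a‖ := by
    refine abs_le_of_sq_le_sq' ?_ (by positivity) |>.2
    nlinarith
  rw [← norm_of]
  exact h3.trans (by gcongr)

/-- The element `F · a` of `A ⊗ K` with entries `θ(F_{ij}) a`, for `F ∈ C ⊗ K` and `a ∈ A`. -/
noncomputable def act (hθ : ∀ f, θ f ∈ Set.center 𝓜(ℂ, A)) (F : Stab C) (a : A) : Stab A :=
  (ofL A ∘L ((FinMat.act θ).flip a).mkContinuous ‖a‖ fun F =>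
    (norm_of_act_le hθ F a).trans_eq (mul_comm _ _)).extend (ofL C) F

variable (hθ : ∀ f, θ f ∈ Set.center 𝓜(ℂ, A))

lemma act_of (F : FinMat C) (a : A) : act hθ (of F) a = of (FinMat.act θ F a) :=
  ContinuousLinearMap.extend_eq (ofL A ∘L ((FinMat.act θ).flip a).mkContinuous ‖a‖ _)
    denseRange_ofL isUniformInducing_ofL F

lemma continuous_act_left (a : A) : Continuous fun F => act hθ F a :=
  ContinuousLinearMap.continuous _

lemma act_add_left (F G : Stab C) (a : A) : act hθ (F + G) a = act hθ F a + act hθ G a :=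
  map_add _ F G

lemma act_add_right (F : Stab C) (a b : A) : act hθ F (a + b) = act hθ F a + act hθ F b := by
  refine induction₁ F (isClosed_eq (continuous_act_left hθ _)
    ((continuous_act_left hθ _).add (continuous_act_left hθ _))) fun F => ?_
  rw [act_of, act_of, act_of, map_add, of_add]

lemma norm_act_le (F : Stab C) (a : A) : ‖act hθ F a‖ ≤ ‖F‖ * ‖a‖ := by
  refine induction₁ F (isClosed_le (continuous_act_left hθ _).norm (by fun_prop)) fun F => ?_
  rw [act_of, norm_of, norm_of]
  exact norm_of_act_le hθ F a

lemma act_zero_right (F : Stab C) : act hθ F (0 : A) = 0 := by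
  simpa using norm_act_le hθ F (0 : A)

lemma act_mul_act (F G : Stab C) (a b : A) :
    act hθ F a * act hθ G b = act hθ (F * G) (a * b) := by
  refine induction₂ F G (isClosed_eq
    (((continuous_act_left hθ _).comp continuous_fst).mul
      ((continuous_act_left hθ _).comp continuous_snd))
    ((continuous_act_left hθ _).comp continuous_mul)) fun F G => ?_
  rw [act_of, act_of, ← of_mul, ← of_mul, act_of, FinMat.act_mul_act hθ]

lemma star_act (F : Stab C) (a : A) : star (act hθ F a) = act hθ (star F) (star a) := by
  refine induction₁ F (isClosed_eq (continuous_act_left hθ _).star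
    ((continuous_act_left hθ _).comp continuous_star)) fun F => ?_
  rw [act_of, ← of_star, ← of_star, act_of, FinMat.star_act hθ]

lemma tendsto_act {F : ℕ → Stab C} {a : ℕ → A} {F₀ : Stab C} {a₀ : A}
    (hF : Tendsto F atTop (𝓝 F₀)) (ha : Tendsto a atTop (𝓝 a₀)) :
    Tendsto (fun n => act hθ (F n) (a n)) atTop (𝓝 (act hθ F₀ a₀)) := by
  have h1 : Tendsto (fun n => act hθ (F n) (a n - a₀)) atTop (𝓝 0) := by
    refine squeeze_zero_norm (fun n => norm_act_le hθ _ _) ?_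
    have := hF.norm.mul (tendsto_iff_norm_sub_tendsto_zero.mp ha)
    rwa [mul_zero] at this
  have h2 := h1.add (((continuous_act_left hθ a₀).tendsto F₀).comp hF)
  rw [zero_add] at h2
  refine h2.congr fun n => ?_
  rw [Function.comp_apply, ← act_add_right, sub_add_cancel]

lemma entry_act (i j : ℕ) (F : Stab C) (a : A) :
    entry i j (act hθ F a) = mulAct (θ (entry i j F)) a := by
  have hθc : Continuous θ := AddMonoidHomClass.continuous_of_bound θ 1 fun f => by
    rw [one_mul]
    exact NonUnitalStarAlgHom.norm_apply_le θ f
  have hc : Continuous fun m : 𝓜(ℂ, A) => mulAct m a :=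
    AddMonoidHomClass.continuous_of_bound (AddMonoidHom.mk' (fun m : 𝓜(ℂ, A) => mulAct m a)
      fun _ _ => rfl) ‖a‖ fun m => by
        rw [← norm_toMult]
        change ‖toMult A (mulAct m a)‖ ≤ _
        rw [toMult_mulAct, ← norm_toMult a, mul_comm]
        exact norm_mul_le _ _
  refine induction₁ F (isClosed_eq ((continuous_entry i j).comp (continuous_act_left hθ a))
    (hc.comp (hθc.comp (continuous_entry i j)))) fun F => ?_
  rw [act_of, entry_of, entry_of, FinMat.coeff_act]

lemma act_single (f : C) (a : A) : act hθ (single f) a = single (mulAct (θ f) a) := by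
  rw [single, act_of, single]
  refine congrArg of ?_
  ext i j
  rw [FinMat.coeff_act]
  simp only [FinMat.single, FinMat.coeff_mk]
  split_ifs
  · rfl
  · rw [map_zero]
    rfl

lemma act_spread (r : Fin 2) (F : Stab C) (a : A) :
    act hθ (spread r F) a = spread r (act hθ F a) := by
  refine induction₁ F (isClosed_eq ((continuous_act_left hθ a).comp (continuous_spread r))
    ((continuous_spread r).comp (continuous_act_left hθ a))) fun F => ?_
  rw [spread_of, act_of, act_of, spread_of]
  refine congrArg of ?_
  ext i j
  rw [FinMat.coeff_act]
  change mulAct (θ ((FinMat.spreadFun r F).coeff i j)) a = (FinMat.spreadFun r _).coeff i j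
  rw [FinMat.coeff_spreadFun, FinMat.coeff_spreadFun]
  split_ifs
  · rfl
  · rw [map_zero]
    rfl

lemma act_dsum (F G : Stab C) (a : A) :
    act hθ (dsum F G) a = dsum (act hθ F a) (act hθ G a) := by
  rw [dsum, act_add_left, act_spread, act_spread, dsum]

end Stab

lemma IsPos.act {A : Type*} [NonUnitalCStarAlgebra A] {C : Type*} [CStarAlgebra C]
    {θ : C →⋆ₐ[ℂ] 𝓜(ℂ, A)} (hθ : ∀ f, θ f ∈ Set.center 𝓜(ℂ, A)) {F : Stab C} {a : A}
    (hF : IsPos F) (ha : IsPos a) : IsPos (Stab.act hθ F a) := by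
  obtain ⟨G, rfl⟩ := hF
  obtain ⟨b, rfl⟩ := ha
  exact ⟨Stab.act hθ G b, by rw [Stab.star_act, Stab.act_mul_act]⟩

lemma CuntzLE.act {A : Type*} [NonUnitalCStarAlgebra A] {C : Type*} [CStarAlgebra C]
    {θ : C →⋆ₐ[ℂ] 𝓜(ℂ, A)} (hθ : ∀ f, θ f ∈ Set.center 𝓜(ℂ, A)) {F F' : Stab C} {a a' : A}
    (hF : CuntzLE F F') (ha : CuntzLE a a') : CuntzLE (Stab.act hθ F a) (Stab.act hθ F' a') := by
  obtain ⟨x, hx⟩ := hF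
  obtain ⟨y, hy⟩ := ha
  refine ⟨fun n => Stab.act hθ (x n) (y n), ?_⟩
  simp only [Stab.star_act, Stab.act_mul_act]
  exact Stab.tendsto_act hθ hx hy

/-! ### Matrix entries and the upper left corner of the stabilization -/

namespace FinMat

variable {A : Type*} [NonUnitalCStarAlgebra A]

lemma continuous_pad (N : ℕ) :
    Continuous (pad : CStarMatrix (Fin N) (Fin N) A → FinMat A) := by
  let _ : PartialOrder A := CStarAlgebra.spectralOrder A
  let _ : StarOrderedRing A := CStarAlgebra.spectralOrderedRing A
  refine AddMonoidHomClass.continuous_of_bound (AddMonoidHom.mk' pad pad_add) 1 fun x => ?_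
  change ‖pad x‖ ≤ 1 * ‖x‖
  rw [one_mul, norm_eq (pad_supp x), corner_pad]
  exact le_rfl

lemma mul_mul_eq_mul_pad_mul {y z : FinMat A} {N : ℕ} (hy : y.Supp N) (hz : z.Supp N)
    (x : FinMat A) : y * x * z = y * pad (corner N x) * z := by
  ext i j
  rw [coeff_mul_of_subset _ _ _ _ (Finset.range N), coeff_mul_of_subset _ _ _ _ (Finset.range N)]
  · refine Finset.sum_congr rfl fun k hk => ?_
    rw [coeff_mul hy, coeff_mul hy]
    refine congrArg (· * _) (Finset.sum_congr rfl fun l hl => ?_)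
    rw [Finset.mem_range] at hk hl
    simp [pad, hk, hl]
  all_goals
    intro k hk
    rw [hz k j (.inl (by simpa using hk)), mul_zero]

lemma single_supp (a : A) : (single a).Supp 1 := fun i j h => if_neg (by omega)

lemma coeff_single (a : A) (i j : ℕ) : (single a).coeff i j = if i = 0 ∧ j = 0 then a else 0 := rfl

end FinMat

namespace Stab

variable {A : Type*} [NonUnitalCStarAlgebra A]

/-- The upper left `N × N` corner of an element of `A ⊗ K`. -/
noncomputable def trunc (N : ℕ) (x : Stab A) : FinMat A :=
  FinMat.pad (CStarMatrix.ofMatrix fun i j : Fin N => entry i j x)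

lemma continuous_trunc (N : ℕ) : Continuous (trunc N : Stab A → FinMat A) :=
  (FinMat.continuous_pad N).comp
    (continuous_pi fun _ => continuous_pi fun _ => continuous_entry _ _)

lemma trunc_of (N : ℕ) (x : FinMat A) : trunc N (of x) = FinMat.pad (FinMat.corner N x) := by
  simp only [trunc, entry_of]
  rfl

/-- Between matrices supported in a corner, only the corner of `x` matters. -/
lemma of_mul_mul_of {y z : FinMat A} {N : ℕ} (hy : y.Supp N) (hz : z.Supp N) (x : Stab A) :
    of y * x * of z = of (y * trunc N x * z) := by
  refine induction₁ x (isClosed_eq (by fun_prop) (continuous_of.comp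
    ((continuous_const.mul (continuous_trunc N)).mul continuous_const))) fun x => ?_
  rw [trunc_of, ← FinMat.mul_mul_eq_mul_pad_mul hy hz, of_mul, of_mul]

lemma entry_sub (i j : ℕ) (x y : Stab A) : entry i j (x - y) = entry i j x - entry i j y := by
  refine induction₂ x y (isClosed_eq ((continuous_entry i j).comp continuous_sub)
    (((continuous_entry i j).comp continuous_fst).sub ((continuous_entry i j).comp continuous_snd)))
    fun x y => ?_
  rw [entry_of, entry_of, show of x - of y = of (x - y) from ((ofL A).map_sub x y).symm, entry_of,
    FinMat.coeff_sub]

/-- An element of `A ⊗ K` is determined by its matrix entries: if those of `d` vanish, then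
`u d v = 0` for all `u` and `v`. -/
lemma ext_entry {x y : Stab A} (h : ∀ i j, entry i j x = entry i j y) : x = y := by
  set d := x - y with hd
  have h0 : ∀ i j, entry i j d = 0 := fun i j => by rw [hd, entry_sub, h, sub_self]
  have h1 : ∀ u v : Stab A, u * d * v = 0 := fun u v => by
    refine induction₂ u v (isClosed_eq (by fun_prop) continuous_const) fun u v => ?_
    obtain ⟨N, hu, hv⟩ := FinMat.exists_supp₂ u v
    have ht : trunc N d = 0 := by
      ext i j
      simp only [trunc, FinMat.pad, h0]
      exact dite_eq_right_iff.mpr fun _ => rfl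
    rw [of_mul_mul_of hu hv, ht, mul_zero, zero_mul, of_zero]
  rw [← sub_eq_zero, ← hd]
  exact eq_of_forall_mul_eq' fun v => eq_of_forall_mul_eq fun u => by
    rw [← mul_assoc, h1, zero_mul, mul_zero]

/-- The *-homomorphism `a ↦ a ⊗ e_{00}`. -/
noncomputable def singleHom (A : Type*) [NonUnitalCStarAlgebra A] : A →⋆ₙₐ[ℂ] Stab A where
  toFun := single
  map_smul' c a := by
    rw [single, single, MonoidHom.id_apply, ← of_smul]
    refine congrArg of ?_
    ext i j
    simp [FinMat.coeff_single]
  map_zero' := by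
    rw [single, ← of_zero]
    refine congrArg of ?_
    ext i j
    simp [FinMat.coeff_single]
  map_add' a b := by
    rw [single, single, single, ← of_add]
    refine congrArg of ?_
    ext i j
    simp only [FinMat.coeff_single, FinMat.coeff_add]
    split_ifs <;> simp
  map_mul' a b := by
    rw [single, single, single, ← of_mul]
    refine congrArg of ?_
    ext i j
    rw [FinMat.coeff_mul (FinMat.single_supp a)]
    by_cases hi : i = 0 <;> by_cases hj : j = 0 <;> simp [FinMat.coeff_single, hi, hj]
  map_star' a := by
    rw [single, single, ← of_star]
    refine congrArg of ?_
    ext i j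
    simp only [FinMat.coeff_single, FinMat.coeff_star, and_comm (a := i = 0)]
    split_ifs <;> simp

lemma single_zero : single (0 : A) = 0 := map_zero (singleHom A)

lemma single_add (a b : A) : single (a + b) = single a + single b := map_add (singleHom A) a b

lemma single_mul (a b : A) : single (a * b) = single a * single b := map_mul (singleHom A) a b

lemma single_star (a : A) : single (star a) = star (single a) := map_star (singleHom A) a

lemma continuous_single : Continuous (single : A → Stab A) :=
  AddMonoidHomClass.continuous_of_bound (singleHom A) 1 fun a => by
    rw [one_mul]
    exact NonUnitalStarAlgHom.norm_apply_le (singleHom A) a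

lemma mul_single_mul_star (x : Stab A) (a : A) :
    entry 0 0 (x * single a * star x) = entry 0 0 x * a * star (entry 0 0 x) := by
  refine induction₁ x (isClosed_eq ((continuous_entry 0 0).comp (by fun_prop))
    (((continuous_entry 0 0).mul continuous_const).mul (continuous_entry 0 0).star)) fun x => ?_
  rw [single, ← of_star, ← of_mul, ← of_mul, entry_of, entry_of,
    FinMat.coeff_mul_of_subset _ _ _ _ {0}, Finset.sum_singleton,
    FinMat.coeff_mul_of_subset _ _ _ _ {0}, Finset.sum_singleton]
  · simp [FinMat.coeff_single]
  · intro k hk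
    simp [FinMat.coeff_single, Finset.mem_singleton.not.mp hk]
  · intro k hk
    obtain ⟨N, hx⟩ := x.exists_supp
    rw [FinMat.coeff_mul hx]
    simp [FinMat.coeff_single, Finset.mem_singleton.not.mp hk]

end Stab

lemma CuntzLE.map {A B : Type*} [NonUnitalCStarAlgebra A] [NonUnitalCStarAlgebra B]
    (φ : A →⋆ₙₐ[ℂ] B) {a a' : A} (h : CuntzLE a a') : CuntzLE (φ a) (φ a') := by
  obtain ⟨x, hx⟩ := h
  have hφ : Continuous φ := AddMonoidHomClass.continuous_of_bound φ 1 fun a => by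
    rw [one_mul]
    exact NonUnitalStarAlgHom.norm_apply_le φ a
  refine ⟨fun n => φ (x n), ?_⟩
  simp only [← map_star, ← map_mul]
  exact (hφ.tendsto a).comp hx

/-- The upper left corner is a hereditary subalgebra of `A ⊗ K`, so that Cuntz comparison in the
corner is the same as in `A ⊗ K`. -/
lemma cuntzLE_of_single {A : Type*} [NonUnitalCStarAlgebra A] {a a' : A}
    (h : CuntzLE (Stab.single a) (Stab.single a')) : CuntzLE a a' := by
  obtain ⟨x, hx⟩ := h
  refine ⟨fun n => Stab.entry 0 0 (x n), ?_⟩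
  have := ((Stab.continuous_entry 0 0).tendsto _).comp hx
  rw [show Stab.entry 0 0 (Stab.single a) = a from Stab.entry_of 0 0 _] at this
  refine this.congr fun n => ?_
  exact Stab.mul_single_mul_star (x n) a'

lemma Stab.single_cut {A : Type*} [NonUnitalCStarAlgebra A] (ε : ℝ) {a : A} (ha : IsPos a) (hε : 0 ≤ ε) :
    Stab.single (cut ε a) = cut ε (Stab.single a) := by
  have hsa : IsSelfAdjoint a := by
    obtain ⟨y, rfl⟩ := ha
    exact .star_mul_self y
  exact NonUnitalStarAlgHom.map_cfcₙ (singleHom A) _ a (continuous_cutFun ε).continuousOn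
    (cutFun_zero hε) continuous_single hsa (hsa.map (singleHom A))

/-! ### Positive elements of the stabilization of a stable algebra -/

section OrthogonalIsometries

variable {A : Type*} [NonUnitalCStarAlgebra A]

lemma star_fst_mul_fst (m n : 𝓜(ℂ, A)) (a b : A) :
    star (m.fst a) * n.fst b = star a * (star m * n).fst b := toMult_injective <| by
  rw [map_mul, map_mul, toMult_fst, toMult_fst, map_star, map_star, toMult_fst, star_mul]
  noncomm_ring

/-- A family of maps `s_i` behaving like the left multiplications by isometries with pairwise
orthogonal ranges. -/
def IsOrthogonalFamily (s : ℕ → A →ₗ[ℂ] A) : Prop :=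
  ∀ i j a b, star (s i a) * s j b = if i = j then star a * b else 0

lemma IsStable.exists_isOrthogonalFamily (hA : IsStable A) :
    ∃ s : ℕ → A →ₗ[ℂ] A, IsOrthogonalFamily s := by
  obtain ⟨ψ⟩ := hA
  let σ : ℕ → ℕ ↪ ℕ := fun i => ⟨Nat.pair i, fun _ _ h => (Nat.pair_eq_pair.mp h).2⟩
  let s : ℕ → A →ₗ[ℂ] A := fun i =>
    { toFun := fun a => ψ.symm ((Stab.shift (σ i)).fst (ψ a))
      map_add' := fun a b => by simp only [map_add]
      map_smul' := fun c a => by simp only [map_smul, RingHom.id_apply] }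
  refine ⟨s, fun i j a b => ?_⟩
  change star (ψ.symm _) * ψ.symm _ = _
  rw [← map_star, ← map_mul, star_fst_mul_fst]
  split_ifs with h
  · subst h
    rw [Stab.star_shift_mul_shift]
    change ψ.symm (star (ψ a) * ψ b) = _
    rw [← map_star, ← map_mul, StarAlgEquiv.symm_apply_apply]
  · rw [Stab.star_shift_mul_shift_of_disjoint fun k l hkl => h (Nat.pair_eq_pair.mp hkl).1]
    change ψ.symm (star (ψ a) * 0) = _
    rw [mul_zero, map_zero]

namespace FinMat

/-- The row with entries `∑ k, s_k y_{kj}`. For isometries `s_k` with orthogonal ranges this is the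
product of the isometric row `(s_0, s_1, …)` with `y`. -/
noncomputable def rowFun (s : ℕ → A →ₗ[ℂ] A) (y : FinMat A) : FinMat A :=
  mk (fun i j => if i = 0 then ∑ k ∈ Finset.range y.size, s k (y.coeff k j) else 0)
    (max y.size 1) fun i j h => by
      split_ifs with hi
      · exact Finset.sum_eq_zero fun k _ => by rw [y.supp_size k j (.inr (by omega)), map_zero]
      · rfl

lemma coeff_rowFun (s : ℕ → A →ₗ[ℂ] A) {y : FinMat A} {N : ℕ} (hy : y.Supp N) (i j : ℕ) :
    (rowFun s y).coeff i j =
      if i = 0 then ∑ k ∈ Finset.range N, s k (y.coeff k j) else 0 := by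
  change (if i = 0 then _ else _) = _
  split_ifs
  · refine Finset.sum_subset (Finset.range_mono (size_le hy)) fun k _ hk => ?_
    rw [y.supp_size k j (.inl (by simpa using hk)), map_zero]
  · rfl

/-- The map `y ↦ (s_0, s_1, …) y`. -/
noncomputable def row (s : ℕ → A →ₗ[ℂ] A) : FinMat A →ₗ[ℂ] FinMat A where
  toFun := rowFun s
  map_add' y z := by
    obtain ⟨N, hy, hz⟩ := exists_supp₂ y z
    ext i j
    rw [coeff_add, coeff_rowFun s hy, coeff_rowFun s hz, coeff_rowFun s (hy.add hz)]
    split_ifs <;> simp [Finset.sum_add_distrib]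
  map_smul' c y := by
    obtain ⟨N, hy⟩ := y.exists_supp
    ext i j
    rw [coeff_smul, coeff_rowFun s hy, coeff_rowFun s (hy.smul _)]
    split_ifs <;> simp [Finset.smul_sum]

lemma coeff_row (s : ℕ → A →ₗ[ℂ] A) {y : FinMat A} {N : ℕ} (hy : y.Supp N) (i j : ℕ) :
    (row s y).coeff i j = if i = 0 then ∑ k ∈ Finset.range N, s k (y.coeff k j) else 0 :=
  coeff_rowFun s hy i j

lemma coeff_row_of_ne (s : ℕ → A →ₗ[ℂ] A) (y : FinMat A) {i : ℕ} (hi : i ≠ 0) (j : ℕ) :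
    (row s y).coeff i j = 0 := by
  rw [coeff_row s y.supp_size, if_neg hi]

lemma star_row_mul_row {s : ℕ → A →ₗ[ℂ] A} (hs : IsOrthogonalFamily s) (y z : FinMat A) :
    star (row s y) * row s z = star y * z := by
  obtain ⟨N, hy, hz⟩ := exists_supp₂ y z
  ext i j
  rw [coeff_mul_of_subset _ _ _ _ {0}, Finset.sum_singleton, coeff_mul hy.star, coeff_star,
    coeff_row s hy, coeff_row s hz, if_pos rfl, if_pos rfl, star_sum, Finset.sum_mul_sum]
  · refine Finset.sum_congr rfl fun k hk => ?_
    simp only [hs k _ _ _, coeff_star]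
    rw [Finset.sum_ite_eq, if_pos hk]
  · intro k hk
    rw [coeff_row_of_ne s z (Finset.mem_singleton.not.mp hk), mul_zero]

lemma norm_row {s : ℕ → A →ₗ[ℂ] A} (hs : IsOrthogonalFamily s) (y : FinMat A) :
    ‖row s y‖ = ‖y‖ := by
  have h := congrArg norm (star_row_mul_row hs y y)
  rw [CStarRing.norm_star_mul_self, CStarRing.norm_star_mul_self] at h
  exact (mul_self_inj (norm_nonneg _) (norm_nonneg _)).mp h

lemma row_mul_star_row (s : ℕ → A →ₗ[ℂ] A) (y : FinMat A) :
    row s y * star (row s y) = single ((row s y * star (row s y)).coeff 0 0) := by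
  obtain ⟨N, hy⟩ := (row s y).exists_supp
  ext i j
  rw [coeff_single]
  split_ifs with h
  · rw [h.1, h.2]
  · rw [coeff_mul hy]
    refine Finset.sum_eq_zero fun k _ => ?_
    rcases not_and_or.mp h with h | h
    · rw [coeff_row_of_ne s y h, zero_mul]
    · rw [coeff_star, coeff_row_of_ne s y h, star_zero, mul_zero]

end FinMat

namespace Stab

/-- The map `y ↦ (s_0, s_1, …) y` on `A ⊗ K`. -/
noncomputable def row {s : ℕ → A →ₗ[ℂ] A} (hs : IsOrthogonalFamily s) : Stab A →L[ℂ] Stab A :=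
  (ofL A ∘L (FinMat.row s).mkContinuous 1 fun y =>
    ((FinMat.norm_row hs y).trans (one_mul _).symm).le).extend (ofL A)

variable {s : ℕ → A →ₗ[ℂ] A} (hs : IsOrthogonalFamily s)

lemma row_of (y : FinMat A) : row hs (of y) = of (FinMat.row s y) :=
  ContinuousLinearMap.extend_eq (ofL A ∘L (FinMat.row s).mkContinuous 1 _)
    denseRange_ofL isUniformInducing_ofL y

lemma star_row_mul_row (y : Stab A) : star (row hs y) * row hs y = star y * y := by
  refine induction₁ y (isClosed_eq (by fun_prop) (by fun_prop)) fun y => ?_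
  rw [row_of, ← of_star, ← of_star, ← of_mul, ← of_mul, FinMat.star_row_mul_row hs]

lemma row_mul_star_row (y : Stab A) :
    row hs y * star (row hs y) = single (entry 0 0 (row hs y * star (row hs y))) := by
  refine induction₁ y (isClosed_eq (by fun_prop)
    (continuous_single.comp ((continuous_entry 0 0).comp (by fun_prop)))) fun y => ?_
  rw [row_of, ← of_star, ← of_mul, entry_of, single, ← FinMat.row_mul_star_row s y]

lemma isPos_entry_mul_star (x : Stab A) : IsPos (entry 0 0 (x * star x)) := by
  let _ : PartialOrder A := CStarAlgebra.spectralOrder A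
  let _ : StarOrderedRing A := CStarAlgebra.spectralOrderedRing A
  rw [isPos_iff]
  refine induction₁ x (isClosed_le continuous_const ((continuous_entry 0 0).comp (by fun_prop)))
    fun x => ?_
  obtain ⟨N, hx⟩ := x.exists_supp
  rw [← of_star, ← of_mul, entry_of, FinMat.coeff_mul hx]
  exact Finset.sum_nonneg fun k _ => mul_star_self_nonneg _

end Stab

/-- For stable `A`, the upper left corner exhausts the Cuntz semigroup: multiplication by a row of
isometries with orthogonal ranges moves `star y * y` into the corner. -/
lemma IsStable.exists_cls (hA : IsStable A) (t : Cu A) : ∃ (a : A) (ha : IsPos a),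
    t = Cu.cls a ha := by
  let _ : PartialOrder (Stab A) := CStarAlgebra.spectralOrder _
  let _ : StarOrderedRing (Stab A) := CStarAlgebra.spectralOrderedRing _
  obtain ⟨c, hc, rfl⟩ := Cu.exists_mk t
  obtain ⟨y, hy⟩ := id hc
  obtain ⟨s, hs⟩ := hA.exists_isOrthogonalFamily
  refine ⟨_, Stab.isPos_entry_mul_star (Stab.row hs y), Cu.mk_eq_mk.mpr ?_⟩
  rw [← Stab.row_mul_star_row, hy, ← Stab.star_row_mul_row hs y]
  exact ⟨cuntzLE_star_mul_self _, cuntzLE_mul_star_self _⟩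

end OrthogonalIsometries

/-! ### Comparison with cut-downs of a product -/

section CutDown

variable {B : Type*} [NonUnitalCStarAlgebra B]

lemma tendsto_cut {a : B} (ha : IsPos a) :
    Tendsto (fun n : ℕ => cut (1 / ((n : ℝ) + 1)) a) atTop (𝓝 a) := by
  let _ : PartialOrder B := CStarAlgebra.spectralOrder B
  let _ : StarOrderedRing B := CStarAlgebra.spectralOrderedRing B
  rw [tendsto_iff_norm_sub_tendsto_zero]
  exact squeeze_zero (fun _ => norm_nonneg _)
    (fun n => norm_cut_sub_le (by positivity) (isPos_iff.mp ha))
    tendsto_one_div_add_atTop_nhds_zero_nat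

/-- If `D` is fixed by left multiplication with `x c x^*`, then it is nearly fixed by that with
`q = x (c - δ)_+ x^*` for small `δ`, and `D^* D ≤ 2 D^* q D ≾ (c - δ)_+`. -/
lemma exists_cuntzLE_cut {c x D : B} (hc : IsPos c) (h : x * c * star x * D = D) :
    ∃ δ > 0, CuntzLE (star D * D) (cut δ c) := by
  let _ : PartialOrder B := CStarAlgebra.spectralOrder B
  let _ : StarOrderedRing B := CStarAlgebra.spectralOrderedRing B
  rw [isPos_iff] at hc
  set δ : ℝ := 1 / (2 * (‖x‖ * ‖x‖ + 1)) with hδ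
  have hδ0 : 0 < δ := by positivity
  have hsa : IsSelfAdjoint (c - cut δ c) := (IsSelfAdjoint.of_nonneg hc).sub (star_cut δ c)
  set b := x * (c - cut δ c) * star x with hb
  have hbsa : IsSelfAdjoint b := hsa.conjugate x
  have hnorm : ‖b‖ ≤ 1 / 2 := by
    have h1 : ‖c - cut δ c‖ ≤ δ := by
      rw [norm_sub_rev]
      exact norm_cut_sub_le hδ0.le hc
    calc ‖b‖ ≤ ‖x‖ * ‖c - cut δ c‖ * ‖star x‖ :=
          (norm_mul_le _ _).trans (by gcongr; exact norm_mul_le _ _)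
      _ ≤ ‖x‖ * δ * ‖x‖ := by rw [norm_star]; gcongr
      _ = δ * (‖x‖ * ‖x‖) := by ring
      _ ≤ δ * (‖x‖ * ‖x‖ + 1) := by gcongr; linarith
      _ = 1 / 2 := by rw [hδ]; field_simp
  have hpos : 0 ≤ star D * D := star_mul_self_nonneg D
  have h1 : star D * b * D ≤ (1 / 2 : ℝ) • (star D * D) :=
    (CStarAlgebra.star_left_conjugate_le_norm_smul hbsa).trans
      (smul_le_smul_of_nonneg_right hnorm hpos)
  have h2 : star D * b * D = star D * D - star D * (x * cut δ c * star x) * D := by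
    have : star D * b * D =
        star D * (x * c * star x * D) - star D * (x * cut δ c * star x) * D := by
      rw [hb]
      noncomm_ring
    rw [this, h]
  set y := Real.sqrt 2 • (star D * x) with hy
  have h3 : y * cut δ c * star y = (2 : ℝ) • (star D * (x * cut δ c * star x) * D) := by
    rw [hy, star_smul, star_trivial (Real.sqrt 2), smul_mul_assoc, smul_mul_assoc, mul_smul_comm, smul_smul,
      Real.mul_self_sqrt zero_le_two, star_mul, star_star]
    congr 1
    noncomm_ring
  refine ⟨δ, hδ0, (cuntzLE_of_le hpos ?_).trans (cuntzLE_conj y (cut δ c))⟩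
  rw [h3]
  rw [h2, sub_le_iff_le_add] at h1
  have h4 : (1 / 2 : ℝ) • (star D * D) ≤ star D * (x * cut δ c * star x) * D := by
    rw [← sub_le_iff_le_add'] at h1
    refine le_trans (le_of_eq ?_) h1
    rw [eq_sub_iff_add_eq, ← add_smul]
    norm_num
  have h5 := smul_le_smul_of_nonneg_left h4 (zero_le_two (α := ℝ))
  rwa [smul_smul, mul_one_div_cancel two_ne_zero, one_smul] at h5

/-- With `h = g(a)` for `g(t) = √t / max(t, ε)` one has `h a h = 1` on the support of
`(a - ε)_+`. -/
lemma exists_conj_mul_root_cut {a : B} (ha : IsPos a) {ε : ℝ} (hε : 0 < ε) :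
    ∃ h r : B, star r * r = cut ε a ∧ h * a * star h * r = r := by
  let _ : PartialOrder B := CStarAlgebra.spectralOrder B
  let _ : StarOrderedRing B := CStarAlgebra.spectralOrderedRing B
  rw [isPos_iff] at ha
  have hm : ∀ t : ℝ, max t ε ≠ 0 := fun t => (hε.trans_le (le_max_right _ _)).ne'
  have hg : Continuous fun t : ℝ => Real.sqrt t / max t ε :=
    Real.continuous_sqrt.div (by fun_prop) hm
  have hr : Continuous fun t : ℝ => Real.sqrt (max (t - ε) 0) := by fun_prop
  have hr0 : Real.sqrt (max (0 - ε) 0) = 0 := by rw [cutFun_zero hε.le, Real.sqrt_zero]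
  refine ⟨cfcₙ (fun t : ℝ => Real.sqrt t / max t ε) a,
    cfcₙ (fun t : ℝ => Real.sqrt (max (t - ε) 0)) a, ?_, ?_⟩
  · rw [star_cfcₙ_real, cfcₙ_mul_cfcₙ hr hr0 hr hr0, cut]
    exact cfcₙ_congr_nonneg ha fun t _ => Real.mul_self_sqrt (le_max_right _ _)
  · rw [star_cfcₙ_real]
    nth_rewrite 2 [← cfcₙ_id ℝ a (IsSelfAdjoint.of_nonneg ha)]
    rw [cfcₙ_mul_cfcₙ hg (by simp) continuous_id rfl,
      cfcₙ_mul_cfcₙ (by fun_prop) (by simp) hg (by simp),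
      cfcₙ_mul_cfcₙ (by fun_prop) (by simp) hr hr0]
    refine cfcₙ_congr_nonneg ha fun t ht => ?_
    rcases le_total t ε with h | h
    · rw [max_eq_right (sub_nonpos.mpr h), Real.sqrt_zero, mul_zero]
    · have ht' : t ≠ 0 := (hε.trans_le h).ne'
      rw [max_eq_left h, id, show Real.sqrt t / t * t * (Real.sqrt t / t) =
        Real.sqrt t * Real.sqrt t / t by field_simp, Real.mul_self_sqrt ht, div_self ht', one_mul]

end CutDown

section Orthogonal

variable {D : Type*} [NonUnitalCStarAlgebra D]

lemma IsPos.add {a b : D} (ha : IsPos a) (hb : IsPos b) : IsPos (a + b) := by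
  let _ : PartialOrder D := CStarAlgebra.spectralOrder D
  let _ : StarOrderedRing D := CStarAlgebra.spectralOrderedRing D
  rw [isPos_iff] at *
  exact add_nonneg ha hb

lemma Cu.mk_add_of_orthogonal {x₁ x₂ : Stab D} (h : x₁ * star x₂ = 0)
    (h' : IsPos (star x₁ * x₁ + star x₂ * x₂)) :
    Cu.mk (star x₁ * x₁ + star x₂ * x₂) h' =
      Cu.mk (star x₁ * x₁) (.star_mul_self x₁) + Cu.mk (star x₂ * x₂) (.star_mul_self x₂) := by
  let _ : PartialOrder (Stab D) := CStarAlgebra.spectralOrder _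
  let _ : StarOrderedRing (Stab D) := CStarAlgebra.spectralOrderedRing _
  have h1 := dsum_equiv_add h
  rw [Cu.mk_add_mk, Cu.mk_eq_mk]
  exact ⟨h1.1.trans (.dsum (cuntzLE_mul_star_self _) (cuntzLE_mul_star_self _)),
    .trans (.dsum (cuntzLE_star_mul_self _) (cuntzLE_star_mul_self _)) h1.2⟩

/-- In a stable algebra two positive elements can be replaced by Cuntz equivalent orthogonal ones. -/
lemma IsStable.exists_orthogonal (hD : IsStable D) {a₁ a₂ : D} (h₁ : IsPos a₁) (h₂ : IsPos a₂) :
    ∃ x₁ x₂ : D, x₁ * star x₂ = 0 ∧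
      (CuntzLE (star x₁ * x₁) a₁ ∧ CuntzLE a₁ (star x₁ * x₁)) ∧
      (CuntzLE (star x₂ * x₂) a₂ ∧ CuntzLE a₂ (star x₂ * x₂)) := by
  obtain ⟨ψ⟩ := hD
  obtain ⟨b₁, rfl⟩ := h₁
  obtain ⟨b₂, rfl⟩ := h₂
  let φ : Stab D →⋆ₙₐ[ℂ] D := (ψ.symm : Stab D →⋆ₙₐ[ℂ] D)
  have hφ : ∀ d, φ (ψ d) = d := ψ.symm_apply_apply
  have key : ∀ (r : Fin 2) (b : D),
      CuntzLE (star (φ (Stab.spread r (ψ b))) * φ (Stab.spread r (ψ b))) (star b * b) ∧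
        CuntzLE (star b * b) (star (φ (Stab.spread r (ψ b))) * φ (Stab.spread r (ψ b))) := by
    intro r b
    have h := Stab.spread_equiv r (IsPos.star_mul_self (ψ b))
    rw [Stab.spread_mul, Stab.spread_star] at h
    have h1 := h.1.map φ
    have h2 := h.2.map φ
    simp only [map_mul, map_star, hφ] at h1 h2
    exact ⟨h1, h2⟩
  refine ⟨φ (Stab.spread 0 (ψ b₁)), φ (Stab.spread 1 (ψ b₂)), ?_, key 0 b₁, key 1 b₂⟩
  rw [← map_star, ← map_mul, ← Stab.spread_star, Stab.spread_mul_spread (by decide), map_zero]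

end Orthogonal

/-! ### The action on the Cuntz semigroup -/

section Action

variable {A : Type*} [NonUnitalCStarAlgebra A] {C : Type*} [CStarAlgebra C]
  {θ : C →⋆ₐ[ℂ] 𝓜(ℂ, A)} (hθ : ∀ f, θ f ∈ Set.center 𝓜(ℂ, A))

/-- Elements `g`, `k` which invert `F`, `a` on the supports of `(F - ε)_+`, `(a - ε)_+` give
`g · k`, which inverts `F · a` on the support of `(F - ε)_+ · (a - ε)_+`. -/
lemma exists_cuntzLE_cut_act {F : Stab C} {a : A} (hF : IsPos F) (ha : IsPos a) {ε : ℝ}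
    (hε : 0 < ε) :
    ∃ δ > 0, CuntzLE (Stab.act hθ (cut ε F) (cut ε a)) (cut δ (Stab.act hθ F a)) := by
  obtain ⟨g, r, hr, hgr⟩ := exists_conj_mul_root_cut hF hε
  obtain ⟨k, s, hs, hks⟩ := exists_conj_mul_root_cut ha hε
  have h : Stab.act hθ g k * Stab.act hθ F a * star (Stab.act hθ g k) * Stab.act hθ r s =
      Stab.act hθ r s := by
    rw [Stab.star_act, Stab.act_mul_act, Stab.act_mul_act, Stab.act_mul_act, hgr, hks]
  obtain ⟨δ, hδ, hle⟩ := exists_cuntzLE_cut (hF.act hθ ha) h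
  rw [Stab.star_act, Stab.act_mul_act, hr, hs] at hle
  exact ⟨δ, hδ, hle⟩

lemma IsPos.mulAct (hθ : ∀ f, θ f ∈ Set.center 𝓜(ℂ, A)) {f : C} {a : A} (hf : IsPos f)
    (ha : IsPos a) : IsPos (mulAct (θ f) a) := by
  obtain ⟨g, rfl⟩ := hf
  obtain ⟨b, rfl⟩ := ha
  exact ⟨CuntzAction.mulAct (θ g) b, by rw [star_mulAct hθ, mulAct_mul_mulAct hθ]⟩

variable (hA : IsStable A)

/-- The map `([F], [a]) ↦ [F · a]`. Every class in `Cu A` is represented by a positive element of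
`A`, since `A` is stable. -/
noncomputable def action (s : Cu C) (t : Cu A) : Cu A :=
  Cu.mk (Stab.act hθ (Cu.exists_mk s).choose (hA.exists_cls t).choose)
    ((Cu.exists_mk s).choose_spec.choose.act hθ (hA.exists_cls t).choose_spec.choose)

lemma action_mk_cls {F : Stab C} (hF : IsPos F) {a : A} (ha : IsPos a) :
    action hθ hA (Cu.mk F hF) (Cu.cls a ha) = Cu.mk (Stab.act hθ F a) (hF.act hθ ha) := by
  have h1 := (Cu.exists_mk (Cu.mk F hF)).choose_spec.choose_spec
  have h2 := (hA.exists_cls (Cu.cls a ha)).choose_spec.choose_spec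
  rw [Cu.mk_eq_mk] at h1
  have h2' := Cu.mk_eq_mk.mp h2
  exact Cu.mk_eq_mk.mpr ⟨.act hθ h1.1 (cuntzLE_of_single h2'.2),
    .act hθ h1.2 (cuntzLE_of_single h2'.1)⟩

lemma Cu.cls_le_cls {a b : A} {ha : IsPos a} {hb : IsPos b} :
    Cu.cls a ha ≤ Cu.cls b hb ↔ CuntzLE a b :=
  ⟨cuntzLE_of_single, fun h => h.map (Stab.singleHom A)⟩

lemma exists_le_cls_cut {t : Cu A} {a : A} (ha : IsPos a)
    (h : CompactlyContained t (Cu.cls a ha)) :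
    ∃ ε > 0, t ≤ Cu.cls (cut ε a) (.cut ε a) := by
  obtain ⟨ε, hε, hle⟩ := exists_le_cut_of_compactlyContained ha.single h
  refine ⟨ε, hε, hle.trans_eq ?_⟩
  simp only [Cu.cls, Stab.single_cut ε ha hε.le]

lemma cls_cut_compactlyContained {a : A} (ha : IsPos a) {ε : ℝ} (hε : 0 < ε) :
    CompactlyContained (Cu.cls (cut ε a) (.cut ε a)) (Cu.cls a ha) := by
  have h := compactlyContained_cut ha.single hε
  simp only [← Stab.single_cut ε ha hε.le] at h
  exact h

lemma cuntzLE_cut_anti {B : Type*} [NonUnitalCStarAlgebra B] {ε δ : ℝ} (hε : 0 ≤ ε) (h : ε ≤ δ)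
    (a : B) : CuntzLE (cut δ a) (cut ε a) := by
  let _ : PartialOrder B := CStarAlgebra.spectralOrder B
  let _ : StarOrderedRing B := CStarAlgebra.spectralOrderedRing B
  exact cuntzLE_of_le (cut_nonneg _ _) (cut_anti hε h a)

lemma action_mono {s s' : Cu C} {t t' : Cu A} (hs : s ≤ s') (ht : t ≤ t') :
    action hθ hA s t ≤ action hθ hA s' t' := by
  obtain ⟨F, hF, rfl⟩ := Cu.exists_mk s
  obtain ⟨F', hF', rfl⟩ := Cu.exists_mk s'
  obtain ⟨a, ha, rfl⟩ := hA.exists_cls t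
  obtain ⟨a', ha', rfl⟩ := hA.exists_cls t'
  rw [action_mk_cls, action_mk_cls]
  exact CuntzLE.act hθ hs (Cu.cls_le_cls.mp ht)

lemma action_add_left (s s' : Cu C) (t : Cu A) :
    action hθ hA (s + s') t = action hθ hA s t + action hθ hA s' t := by
  obtain ⟨F, hF, rfl⟩ := Cu.exists_mk s
  obtain ⟨F', hF', rfl⟩ := Cu.exists_mk s'
  obtain ⟨a, ha, rfl⟩ := hA.exists_cls t
  simp only [Cu.mk_add_mk, action_mk_cls, Stab.act_dsum]

/-- For orthogonal `x₁`, `x₂` as in `IsStable.exists_orthogonal` and `F = G^* G`, the elements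
`G · x₁` and `G · x₂` are again orthogonal, and sums of orthogonal elements give the sum in `Cu`. -/
lemma action_add_right (s : Cu C) (t t' : Cu A) :
    action hθ hA s (t + t') = action hθ hA s t + action hθ hA s t' := by
  obtain ⟨F, hF, rfl⟩ := Cu.exists_mk s
  obtain ⟨a, ha, rfl⟩ := hA.exists_cls t
  obtain ⟨a', ha', rfl⟩ := hA.exists_cls t'
  obtain ⟨x₁, x₂, h, h₁, h₂⟩ := hA.exists_orthogonal ha ha'
  obtain ⟨G, hG⟩ := id hF
  have e₁ : Cu.cls a ha = Cu.cls (star x₁ * x₁) (.star_mul_self x₁) :=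
    le_antisymm (Cu.cls_le_cls.mpr h₁.2) (Cu.cls_le_cls.mpr h₁.1)
  have e₂ : Cu.cls a' ha' = Cu.cls (star x₂ * x₂) (.star_mul_self x₂) :=
    le_antisymm (Cu.cls_le_cls.mpr h₂.2) (Cu.cls_le_cls.mpr h₂.1)
  have hp : IsPos (star x₁ * x₁ + star x₂ * x₂) := (IsPos.star_mul_self x₁).add (.star_mul_self x₂)
  have es : ∀ x : A, Stab.single (star x * x) = star (Stab.single x) * Stab.single x := fun x => by
    rw [Stab.single_mul, Stab.single_star]
  have ea : ∀ x : A, Stab.act hθ F (star x * x) = star (Stab.act hθ G x) * Stab.act hθ G x :=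
    fun x => by rw [Stab.star_act, Stab.act_mul_act, hG]
  have e₃ : Cu.cls a ha + Cu.cls a' ha' = Cu.cls (star x₁ * x₁ + star x₂ * x₂) hp := by
    have h0 : Stab.single x₁ * star (Stab.single x₂) = 0 := by
      rw [← Stab.single_star, ← Stab.single_mul, h, Stab.single_zero]
    have := Cu.mk_add_of_orthogonal h0 (.add (.star_mul_self _) (.star_mul_self _))
    rw [e₁, e₂]
    simp only [← es] at this
    simp only [← Stab.single_add] at this
    exact this.symm
  have h0 : Stab.act hθ G x₁ * star (Stab.act hθ G x₂) = 0 := by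
    rw [Stab.star_act, Stab.act_mul_act, h, Stab.act_zero_right]
  have := Cu.mk_add_of_orthogonal h0 (.add (.star_mul_self _) (.star_mul_self _))
  rw [e₃, e₁, e₂, action_mk_cls, action_mk_cls, action_mk_cls]
  simp only [← ea, ← Stab.act_add_right] at this
  exact this

lemma isBimorphism_action : IsBimorphism (action hθ hA) where
  right s :=
    { monotone := fun t t' ht => action_mono hθ hA le_rfl ht
      map_add := action_add_right hθ hA s
      map_sup := by
        refine isLUB_of_compactlyContained (fun t t' ht => action_mono hθ hA le_rfl ht)
          fun t u h => ?_
        obtain ⟨F, hF, rfl⟩ := Cu.exists_mk s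
        obtain ⟨a, ha, rfl⟩ := hA.exists_cls t
        obtain ⟨b, hb, rfl⟩ := Cu.exists_mk u
        rw [action_mk_cls]
        refine (isClosed_cuntzLE b).mem_of_tendsto
          (Stab.tendsto_act hθ tendsto_const_nhds (tendsto_cut ha)) (.of_forall fun n => ?_)
        have := h _ (cls_cut_compactlyContained ha (ε := 1 / ((n : ℝ) + 1)) (by positivity))
        rwa [action_mk_cls] at this }
  left t :=
    { monotone := fun s s' hs => action_mono hθ hA hs le_rfl
      map_add := fun s s' => action_add_left hθ hA s s' t
      map_sup := by
        refine isLUB_of_compactlyContained (fun s s' hs => action_mono hθ hA hs le_rfl)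
          fun s u h => ?_
        obtain ⟨F, hF, rfl⟩ := Cu.exists_mk s
        obtain ⟨a, ha, rfl⟩ := hA.exists_cls t
        obtain ⟨b, hb, rfl⟩ := Cu.exists_mk u
        rw [action_mk_cls]
        refine (isClosed_cuntzLE b).mem_of_tendsto
          (Stab.tendsto_act hθ (tendsto_cut hF) tendsto_const_nhds) (.of_forall fun n => ?_)
        have := h _ (compactlyContained_cut hF (ε := 1 / ((n : ℝ) + 1)) (by positivity))
        rwa [action_mk_cls] at this }
  compactlyContained s' s t' t hs ht := by
    obtain ⟨F, hF, rfl⟩ := Cu.exists_mk s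
    obtain ⟨a, ha, rfl⟩ := hA.exists_cls t
    obtain ⟨ε₁, hε₁, h₁⟩ := exists_le_cut_of_compactlyContained hF hs
    obtain ⟨ε₂, hε₂, h₂⟩ := exists_le_cls_cut ha ht
    have hε : 0 < min ε₁ ε₂ := lt_min hε₁ hε₂
    have h₁' := h₁.trans (Cu.mk_le_mk (hb := .cut (min ε₁ ε₂) F) |>.mpr
      (cuntzLE_cut_anti hε.le (min_le_left _ _) F))
    have h₂' := h₂.trans (Cu.cls_le_cls (hb := .cut (min ε₁ ε₂) a) |>.mpr
      (cuntzLE_cut_anti hε.le (min_le_right _ _) a))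
    obtain ⟨δ, hδ, hle⟩ := exists_cuntzLE_cut_act hθ hF ha hε
    refine ((compactlyContained_cut (hF.act hθ ha) hδ).mono ?_ le_rfl).mono
      (action_mono hθ hA h₁' h₂') (action_mk_cls hθ hA hF ha).ge
    rw [action_mk_cls]
    exact hle

end Action

end CuntzAction

theorem mainTheorem9 {X : Type*} [TopologicalSpace X] [CompactSpace X] [T2Space X]
    {A : Type*} [NonUnitalCStarAlgebra A]
    (θ : C(X, ℂ) →⋆ₐ[ℂ] 𝓜(ℂ, A)) (hθ : ∀ f, θ f ∈ Set.center 𝓜(ℂ, A)) (hA : IsStable A) :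
    ∃! γ : Cu C(X, ℂ) → Cu A → Cu A,
      IsBimorphism γ ∧
      (∀ (f : C(X, ℂ)) (hf : IsPos f) (a : A) (ha : IsPos a),
        ∃ h : IsPos (mulAct (θ f) a), γ (Cu.cls f hf) (Cu.cls a ha) = Cu.cls (mulAct (θ f) a) h) ∧
      (∀ (F : Stab C(X, ℂ)) (hF : IsPos F) (a : A) (ha : IsPos a),
        ∃ (c : Stab A) (hc : IsPos c),
          (∀ i j, Stab.entry i j c = mulAct (θ (Stab.entry i j F)) a) ∧
          γ (Cu.mk F hF) (Cu.cls a ha) = Cu.mk c hc) := by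
  refine ⟨action hθ hA, ⟨isBimorphism_action hθ hA, fun f hf a ha => ?_, fun F hF a ha => ?_⟩,
    fun γ hγ => ?_⟩
  · refine ⟨hf.mulAct hθ ha, ?_⟩
    rw [Cu.cls, action_mk_cls]
    simp only [Cu.cls, Stab.act_single]
  · exact ⟨Stab.act hθ F a, hF.act hθ ha, fun i j => Stab.entry_act hθ i j F a,
      action_mk_cls hθ hA hF ha⟩
  · funext s t
    obtain ⟨F, hF, rfl⟩ := Cu.exists_mk s
    obtain ⟨a, ha, rfl⟩ := hA.exists_cls t
    obtain ⟨c, hc, hentry, hγc⟩ := hγ.2.2 F hF a ha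
    obtain rfl : c = Stab.act hθ F a :=
      Stab.ext_entry fun i j => (hentry i j).trans (Stab.entry_act hθ i j F a).symm
    rw [hγc, action_mk_cls]
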